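/- Let $p>2$ be a prime, let $F$ be a field containing a primitive $p$th root of unity, and let $K/F$ be a cyclic extension of degree $p$ with group $G=\mathrm{Gal}(K/F)=\langle\sigma\rangle$. Put $\rho=\sigma-1$, so that $\omega^{\rho}=\sigma(\omega)/\omega$ for $\omega\in K^\times$, and write $[\omega]$ for the class of $\omega$ in $K^\times/K^{\times p}$. Let $A=\mathbb F_p[G]$, in which $\tau$ denotes the element $\sigma$, let $A_i\subseteq A$ be the submodule generated by $(\tau-1)^i$, and let $B_{i,0}=(A/A_i)\rtimes G$ for $1\le i\le p$. Let $p\ge i>j\ge 1$, let $\gamma\in K^\times$, and let $L$ be the Galois closure of $K(\sqrt[p]{\gamma})$ over $F$. Suppose that $\mathrm{Gal}(L/F)\cong B_{j,0}$ as extensions of $G$ (that is, compatibly with the restriction map $\mathrm{Gal}(L/F)\to G$), and consider the Galois embedding problem $$\mathcal E_{i,j}(L)\colon\quad 1\to A_j/A_i\to B_{i,0}\to (A/A_j)\rtimes G=\mathrm{Gal}(L/F)\to 1 .$$ A solution is a Galois extension $\tilde L/F$ containing $L$ (inside a fixed algebraically closed extension of $K$) for which there are isomorphisms $\psi\colon\mathrm{Gal}(\tilde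 L/F)\cong B_{i,0}$ and $\varphi\colon\mathrm{Gal}(L/F)\cong B_{j,0}$, the latter compatible with the projections onto $G$, that identify the restriction map $\mathrm{Gal}(\tilde L/F)\to\mathrm{Gal}(L/F)$ with the natural surjection $B_{i,0}\to B_{j,0}$. Then: 1. $\mathcal E_{i,j}(L)$ is solvable if and only if $[\gamma]=[\omega]^{\rho^{p-j}}$ for some $\omega\in K^\times$. 2. For all $\omega\in K^\times$ with $[\omega]^{\rho^{p-j}}=[\gamma]$ and all $f\in F^\times$, the field $$\tilde L=L\Bigl(\sqrt[p]{f\omega^{\rho^{p-i}}},\ \sqrt[p]{\omega^{\rho^{p-i+1}}},\ \dots,\ \sqrt[p]{\omega^{\rho^{p-j-1}}}\Bigr)$$ is a solution of $\mathcal E_{i,j}(L)$; in the case $i=j+1$ this means $\tilde L=L\bigl(\sqrt[p]{f\omega^{\rho^{p-i}}}\bigr)$. Conversely, every solution of $\mathcal E_{i,j}(L)$ is of this form for some such $\omega$ and $f$. 3. If $i<p$, the identification $\varphi$ may be prescribed: every solution of $\mathcal E_{i,j}(L)$ is a solution with respect to each isomorphism $\varphi\colon\mathrm{Gal}(L/F)\cong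 B_{j,0}$ that is compatible with the projections onto $G$. -/

import Mathlib

namespace GaloisModuleEmbedding

/-! ### The groups `B_{i,0} = (A / A_i) ⋊ G` -/

section Groups

variable (p : ℕ) {G : Type*} [Group G] (σ : G)

/-- The submodule `A_i` of `A = 𝔽_p[G]` generated by `(τ - 1)^i`. Here `A` is free of rank one over
`𝔽_p[G]`, and `τ` is the group element `σ`, so that `σ` acts as multiplication by `τ`. -/
noncomputable def subA (i : ℕ) : Submodule (MonoidAlgebra (ZMod p) G) (MonoidAlgebra (ZMod p) G) :=
  Submodule.span _ {(MonoidAlgebra.of (ZMod p) G σ - 1) ^ i}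

theorem subA_anti {i j : ℕ} (h : j ≤ i) : subA p σ i ≤ subA p σ j := by
  refine Submodule.span_le.2 (Set.singleton_subset_iff.2 ?_)
  rw [← Nat.sub_add_cancel h, pow_add]
  exact Submodule.smul_mem _ _ (Submodule.subset_span rfl)

/-- The quotient module `A / A_i`. -/
abbrev quotA (i : ℕ) : Type _ := MonoidAlgebra (ZMod p) G ⧸ subA p σ i

/-- The action of `G` on `A / A_i`: the element `g` acts as multiplication by `g ∈ 𝔽_p[G]`. -/
noncomputable def actA (i : ℕ) : G →* MulAut (Multiplicative (quotA p σ i)) :=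
  (MulAutMultiplicative (quotA p σ i)).symm.toMonoidHom.comp
    ((DistribMulAction.toAddAut (MonoidAlgebra (ZMod p) G)ˣ (quotA p σ i)).comp
      (MonoidAlgebra.of (ZMod p) G).toHomUnits)

theorem actA_apply (i : ℕ) (g : G) (x : quotA p σ i) :
    actA p σ i g (Multiplicative.ofAdd x) =
      Multiplicative.ofAdd (MonoidAlgebra.of (ZMod p) G g • x) := rfl

/-- The split extension `B_{i,0} = (A / A_i) ⋊ G` of `G` by `A / A_i`. -/
abbrev groupB (i : ℕ) : Type _ := Multiplicative (quotA p σ i) ⋊[actA p σ i] G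

/-- The natural surjection `B_{i,0} → B_{j,0}` for `j ≤ i`, with kernel `A_j / A_i`, induced by the
projection `A / A_i → A / A_j` and the identity of `G`. -/
noncomputable def projB {i j : ℕ} (h : j ≤ i) : groupB p σ i →* groupB p σ j :=
  SemidirectProduct.map
    (AddMonoidHom.toMultiplicative (Submodule.factor (subA_anti p σ h)).toAddMonoidHom)
    (MonoidHom.id G) (by
      intro g
      ext x
      induction x using Multiplicative.rec with | _ x => ?_
      exact congrArg Multiplicative.ofAdd
        ((Submodule.factor (subA_anti p σ h)).map_smul (MonoidAlgebra.of (ZMod p) G g) x))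

end Groups

/-! ### The embedding problem and the explicit fields -/

section Fields

variable (p : ℕ) {F Ω : Type*} [Field F] [Field Ω] [Algebra F Ω]

/-- The automorphism `g` of `M` restricts to the automorphism `h` of the subfield `E`. -/
def IsRestriction {M E : IntermediateField F Ω} (g : M ≃ₐ[F] M) (h : E ≃ₐ[F] E) : Prop :=
  ∀ (x : Ω) (hM : x ∈ M) (hE : x ∈ E), (g ⟨x, hM⟩ : Ω) = h ⟨x, hE⟩

variable {K : IntermediateField F Ω} (σ : K ≃ₐ[F] K)

/-- `φ` is an isomorphism `Gal(L/F) ≅ (A / A_j) ⋊ G` of `G`-extensions, `G = Gal(K/F)`: the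
projection onto `G` corresponds to the restriction of automorphisms to `K`. -/
def IsIdentification {j : ℕ} (L : IntermediateField F Ω) (φ : (L ≃ₐ[F] L) ≃* groupB p σ j) :
    Prop :=
  ∀ (g : L ≃ₐ[F] L) (h : K ≃ₐ[F] K), IsRestriction g h → (φ g).right = h

/-- `Lt` is a Galois extension of `F` containing `L`, with an isomorphism `Gal(Lt/F) ≅ B_{i,0}`
under which the restriction map `Gal(Lt/F) → Gal(L/F)` is the natural surjection
`B_{i,0} → B_{j,0}`, where `Gal(L/F)` is identified with `B_{j,0}` through `φ`. -/
def IsSolutionFor {i j : ℕ} (hij : j ≤ i) (L : IntermediateField F Ω)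
    (φ : (L ≃ₐ[F] L) ≃* groupB p σ j) (Lt : IntermediateField F Ω) : Prop :=
  L ≤ Lt ∧ IsGalois F Lt ∧
    ∃ ψ : (Lt ≃ₐ[F] Lt) ≃* groupB p σ i,
      ∀ (g : Lt ≃ₐ[F] Lt) (h : L ≃ₐ[F] L), IsRestriction g h → projB p σ hij (ψ g) = φ h

/-- `Lt` is a solution of the embedding problem
`1 → A_j / A_i → B_{i,0} → (A / A_j) ⋊ G = Gal(L/F) → 1`: the restriction map
`Gal(Lt/F) → Gal(L/F)` is identified with the natural surjection `B_{i,0} → B_{j,0}` through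
isomorphisms of `G`-extensions. -/
def IsSolution {i j : ℕ} (hij : j ≤ i) (L Lt : IntermediateField F Ω) : Prop :=
  ∃ φ : (L ≃ₐ[F] L) ≃* groupB p σ j, IsIdentification p σ L φ ∧ IsSolutionFor p σ hij L φ Lt

/-- The group `Kˣ / Kˣᵖ`. -/
abbrev PowerClasses (E : Type*) [Field E] : Type _ := Eˣ ⧸ (powMonoidHom p : Eˣ →* Eˣ).range

/-- `ω ↦ ω ^ ((σ - 1)^k)`, where `ω ^ (σ - 1) = σ(ω) / ω`. -/
def rhoPow (k : ℕ) (ω : Kˣ) : Kˣ :=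
  (fun u : Kˣ => Units.map (σ : K →* K) u / u)^[k] ω

/-- The field `K(ᵖ√γ)`. -/
def rootField (γ : Kˣ) : IntermediateField F Ω :=
  K ⊔ IntermediateField.adjoin F {x : Ω | x ^ p = ((γ : K) : Ω)}

/-- The field `L(ᵖ√(f ω^{ρ^{p-i}}), ᵖ√(ω^{ρ^{p-i+1}}), …, ᵖ√(ω^{ρ^{p-j-1}}))`, where `ρ = σ - 1`. -/
def solutionField (i j : ℕ) (L : IntermediateField F Ω) (f : Fˣ) (ω : Kˣ) :
    IntermediateField F Ω :=
  L ⊔ IntermediateField.adjoin F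
    ({x : Ω | x ^ p = algebraMap F Ω f * ((rhoPow σ (p - i) ω : K) : Ω)} ∪
      {x : Ω | ∃ k : ℕ, p - i + 1 ≤ k ∧ k + 1 ≤ p - j ∧ x ^ p = ((rhoPow σ k ω : K) : Ω)})

end Fields

end GaloisModuleEmbedding

namespace GaloisModuleEmbedding

/-! ### The norm polynomial modulo `p` -/

section NormPolynomial

open Polynomial

/-! Kummer theory turns the embedding problem into a question about radicals. All fields involved
have the form `kummerField p σ δ`: `K` with the `p`th roots of the conjugates of one `δ` adjoined.
Since the `p`th roots of unity lie in `F`, `G` acts trivially on them, and under the Kummer pairing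
`τ⁻¹ - 1` acting on `Gal(E/K)` is adjoint to `ρ` acting on radicals (`isPair_augGen_pow`). The
ideals `A_m` form a chain, so if `δ^{ρ^i}` is a `p`th power, an automorphism over `K` that moves the
`p`th roots of `δ^{ρ^{i-1}}` generates `Gal(E/K)` as a module isomorphic to `A/A_i`. What remains is
splitting: a lift `s` of `σ` with `s^p = 1` gives `Gal(E/F) ≅ B_{i,0}` (`exists_identification`).

For `y^p = δ` put `n = y s(y) ⋯ s^{p-1}(y)`. Then `s^p(y)/y = s(n)/n` and `n^p = N(δ)`, so `s^p = 1`
as soon as `s` fixes `n`. Take `δ = f ω^{ρ^{p-i}}`. If `i < p`, then `N(δ) = f^p`, so `n` lies in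
`F` and every lift works; hence `φ` can be prescribed. If `i = p`, a lift is corrected by a power of
the generator of the kernel until it fixes a `p`th root of `N(δ)`, at the cost of changing `φ`
(`exists_lift_pow_eq_one`).

Conversely, in a solution the Kummer character of `γ` is a functional on `A/A_i` that vanishes on
`A_j/A_i`. By duality it is divisible by `(τ⁻¹ - 1)^{i-j}`, and the quotient is the Kummer character
of some `δ` with `[δ]^{ρ^{i-j}} = [γ]` (`exists_radical_of_isSolution`). If `i < p`, the splitting
forces `N(δ)` to be a `p`th power in `F`, and repeated use of Hilbert 90 writes `δ` as `f
ω^{ρ^{p-i}}` (`exists_eq_baseUnit_mul_rhoPow`); this is where `p` odd enters. -/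

theorem geom_sum_X_zmod (p : ℕ) [Fact p.Prime] :
    ∑ k ∈ Finset.range p, (X : (ZMod p)[X]) ^ k = (X - 1) ^ (p - 1) := by
  have hX : (X - 1 : (ZMod p)[X]) ≠ 0 := by
    simpa using Polynomial.X_sub_C_ne_zero (1 : ZMod p)
  apply mul_right_cancel₀ hX
  rw [geom_sum_mul, ← pow_succ, Nat.sub_add_cancel (Fact.out : p.Prime).one_le, sub_pow_char,
    one_pow]

/-- `1 + X + ⋯ + X ^ (p - 1)` is congruent to `(X - 1) ^ (p - 1)` modulo `p`. -/
theorem exists_geom_sum_X_eq (p : ℕ) (hp : p.Prime) :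
    ∃ Q : ℤ[X], ∑ k ∈ Finset.range p, (X : ℤ[X]) ^ k = (X - 1) ^ (p - 1) + C (p : ℤ) * Q := by
  have := Fact.mk hp
  have h : C (p : ℤ) ∣ ∑ k ∈ Finset.range p, (X : ℤ[X]) ^ k - (X - 1) ^ (p - 1) := by
    rw [C_dvd_iff_dvd_coeff]
    intro n
    rw [← ZMod.intCast_zmod_eq_zero_iff_dvd, ← eq_intCast (Int.castRingHom (ZMod p)), ← coeff_map]
    simp [Polynomial.map_sum, geom_sum_X_zmod]
  obtain ⟨Q, hQ⟩ := h
  exact ⟨Q, by rw [← hQ]; ring⟩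

end NormPolynomial

/-! ### The group algebra of a cyclic group of order `p` over `𝔽_p` -/

section GroupAlgebra

open Polynomial

variable {p : ℕ} {G : Type*} [Group G] {σ : G}

local notation "A" => MonoidAlgebra (ZMod p) G

/-- The element `τ - 1` of the group algebra, where `τ` is the group element `σ`. -/
noncomputable def augGen (p : ℕ) {G : Type*} [Group G] (σ : G) : MonoidAlgebra (ZMod p) G :=
  MonoidAlgebra.of (ZMod p) G σ - 1

theorem commute_augGen (hσ : ∀ g : G, g ∈ Subgroup.zpowers σ) (a : A) :
    Commute (augGen p σ) a := by
  have key (g : G) : Commute (MonoidAlgebra.of (ZMod p) G σ) (MonoidAlgebra.of (ZMod p) G g) := by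
    obtain ⟨k, rfl⟩ := hσ g
    rw [commute_iff_eq, ← map_mul, ← map_mul]
    congr 1
    exact ((Commute.refl σ).zpow_right k).eq
  refine Commute.sub_left ?_ (Commute.one_left a)
  induction a using MonoidAlgebra.induction_on with
  | of g => exact key g
  | add x y hx hy => exact hx.add_right hy
  | smul r x hx => exact hx.smul_right r

theorem mem_subA_iff {i : ℕ} {x : A} : x ∈ subA p σ i ↔ ∃ a : A, x = a * augGen p σ ^ i := by
  rw [subA, Submodule.mem_span_singleton]
  exact exists_congr fun a => eq_comm

theorem mul_augGen_pow_mem (i : ℕ) (a : A) : a * augGen p σ ^ i ∈ subA p σ i :=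
  mem_subA_iff.2 ⟨a, rfl⟩

/-- Every element is a scalar modulo the augmentation ideal, which `τ - 1` generates. -/
theorem exists_eq_algebraMap_add (hσ : ∀ g : G, g ∈ Subgroup.zpowers σ) (a : A) :
    ∃ (c : ZMod p) (b : A), a = algebraMap (ZMod p) A c + b * augGen p σ := by
  have hgen (k : ℕ) : ∃ b : A, MonoidAlgebra.of (ZMod p) G (σ ^ k) = 1 + b * augGen p σ := by
    induction k with
    | zero => exact ⟨0, by simp [MonoidAlgebra.one_def]⟩
    | succ k ih =>
      obtain ⟨b, hb⟩ := ih
      refine ⟨MonoidAlgebra.of (ZMod p) G (σ ^ k) + b, ?_⟩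
      have h1 : MonoidAlgebra.of (ZMod p) G σ = augGen p σ + 1 := (sub_add_cancel _ _).symm
      rw [pow_succ, map_mul, h1, mul_add, mul_one, add_mul, hb]
      abel
  induction a using MonoidAlgebra.induction_on with
  | of g =>
    obtain ⟨k, rfl⟩ := hσ g
    have key : ∃ b : A, MonoidAlgebra.of (ZMod p) G (σ ^ k) = 1 + b * augGen p σ := by
      cases k with
      | ofNat k => simpa using hgen k
      | negSucc k =>
        obtain ⟨b, hb⟩ := hgen (k + 1)
        refine ⟨-(MonoidAlgebra.of (ZMod p) G (σ ^ Int.negSucc k) * b), ?_⟩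
        have h2 : MonoidAlgebra.of (ZMod p) G (σ ^ Int.negSucc k) *
            MonoidAlgebra.of (ZMod p) G (σ ^ (k + 1)) = 1 := by
          rw [← map_mul, zpow_negSucc, inv_mul_cancel, map_one]
        rw [hb, mul_add, mul_one, ← mul_assoc] at h2
        rw [neg_mul, eq_comm, ← sub_eq_add_neg, sub_eq_iff_eq_add]
        exact h2.symm
    obtain ⟨b, hb⟩ := key
    exact ⟨1, b, by rw [map_one]; exact hb⟩
  | add x y hx hy =>
    obtain ⟨c, b, rfl⟩ := hx
    obtain ⟨c', b', rfl⟩ := hy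
    exact ⟨c + c', b + b', by rw [map_add, add_mul]; abel⟩
  | smul r x hx =>
    obtain ⟨c, b, rfl⟩ := hx
    exact ⟨r * c, r • b, by
      rw [smul_add, map_mul, smul_mul_assoc, Algebra.smul_def r (algebraMap _ _ c)]⟩

variable [Fact p.Prime]

instance : CharP A p := charP_of_injective_algebraMap (algebraMap (ZMod p) A).injective p

theorem augGen_pow_prime (hord : orderOf σ = p) : augGen p σ ^ p = 0 := by
  have h : (X - 1 : (ZMod p)[X]) ^ p = X ^ p - 1 := by rw [sub_pow_char, one_pow]
  have h2 := congrArg (Polynomial.aeval (MonoidAlgebra.of (ZMod p) G σ)) h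
  simp only [map_pow, map_sub, aeval_X, map_one] at h2
  have h3 : σ ^ p = 1 := by rw [← orderOf_dvd_iff_pow_eq_one, hord]
  rw [augGen, h2, ← map_pow, h3, map_one, sub_self]

/-- This power is the sum of all `σ^k` with `k < p`, whose coefficient at the identity is `1`. -/
theorem augGen_pow_pred_ne_zero (hord : orderOf σ = p) : augGen p σ ^ (p - 1) ≠ 0 := by
  have h2 := congrArg (Polynomial.aeval (MonoidAlgebra.of (ZMod p) G σ)) (geom_sum_X_zmod p)
  simp only [map_pow, map_sub, map_sum, aeval_X, map_one] at h2
  intro h0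
  rw [← augGen, h0] at h2
  have h3 := congrArg (fun x : A => x.coeff 1) h2
  have hp0 : 0 < p := (Fact.out : p.Prime).pos
  simp only [MonoidAlgebra.of_apply] at h3
  rw [MonoidAlgebra.coeff_sum, Finsupp.finsetSum_apply, Finset.sum_eq_single 0] at h3
  · simp at h3
  · intro k hk hk0
    have : σ ^ k ≠ 1 := by
      intro h
      exact Nat.not_dvd_of_pos_of_lt (Nat.pos_of_ne_zero hk0) (Finset.mem_range.1 hk)
        (hord ▸ orderOf_dvd_of_pow_eq_one h)
    simp [this]
  · intro h
    exact absurd (Finset.mem_range.2 hp0) h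

/-- Otherwise multiplication by `(τ - 1)^{p-i}` would make `(τ - 1)^{p-1}` a multiple of `(τ - 1)^p
= 0`. -/
theorem augGen_pow_pred_notMem (hord : orderOf σ = p) {i : ℕ} (hi1 : 1 ≤ i) (hip : i ≤ p) :
    augGen p σ ^ (i - 1) ∉ subA p σ i := by
  intro h
  obtain ⟨a, ha⟩ := mem_subA_iff.1 h
  apply augGen_pow_pred_ne_zero hord
  have e1 : p - 1 = (i - 1) + (p - i) := by omega
  have e2 : i + (p - i) = p := by omega
  rw [e1, pow_add, ha, mul_assoc, ← pow_add, e2, augGen_pow_prime hord, mul_zero]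

/-- An element outside `A_i` equals `c (τ - 1)^m` modulo `A_{m+1}` for some `m < i` and a nonzero
scalar `c`. -/
theorem exists_eq_of_notMem_subA (hσ : ∀ g : G, g ∈ Subgroup.zpowers σ) {i : ℕ} {x : A}
    (hx : x ∉ subA p σ i) : ∃ m < i, ∃ c : ZMod p, c ≠ 0 ∧ ∃ b : A,
      x = algebraMap (ZMod p) A c * augGen p σ ^ m + b * augGen p σ ^ (m + 1) := by
  induction i with
  | zero => exact absurd (mem_subA_iff.2 ⟨x, by simp⟩) hx
  | succ i ih =>
    by_cases h : x ∈ subA p σ i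
    · obtain ⟨a, ha⟩ := mem_subA_iff.1 h
      obtain ⟨c, b, hb⟩ := exists_eq_algebraMap_add hσ a
      refine ⟨i, i.lt_succ_self, c, ?_, b, ?_⟩
      · rintro rfl
        refine hx (mem_subA_iff.2 ⟨b, ?_⟩)
        rw [ha, hb, map_zero, zero_add, mul_assoc, ← pow_succ']
      · rw [ha, hb, add_mul, mul_assoc b, ← pow_succ']
    · obtain ⟨m, hm, h⟩ := ih h
      exact ⟨m, hm.trans i.lt_succ_self, h⟩

/-- A power of `τ - 1` pushes the leading term of `x` into the socle of `A/A_i`, spanned by `(τ -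
1)^{i-1}`. Nonvanishing on any nonzero submodule can thus be tested on this one element. -/
theorem exists_pow_mul_sub_mem (hσ : ∀ g : G, g ∈ Subgroup.zpowers σ) {i : ℕ} {x : A}
    (hx : x ∉ subA p σ i) : ∃ (k : ℕ) (c : ZMod p), c ≠ 0 ∧
      augGen p σ ^ k * x - c • augGen p σ ^ (i - 1) ∈ subA p σ i := by
  obtain ⟨m, hm, c, hc, b, rfl⟩ := exists_eq_of_notMem_subA hσ hx
  refine ⟨i - 1 - m, c, hc, mem_subA_iff.2 ⟨b, ?_⟩⟩
  have e1 : m + (i - 1 - m) = i - 1 := by omega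
  have e2 : (m + 1) + (i - 1 - m) = i := by omega
  rw [((commute_augGen hσ _).pow_left _).eq, add_mul, mul_assoc, mul_assoc, ← pow_add, ← pow_add,
    e1, e2, Algebra.smul_def, add_sub_cancel_left]

/-- If `x` were outside `A_j`, a multiple of it would be `c (τ - 1)^{j-1}` modulo `A_j` with `c ≠
0`; times `(τ - 1)^{i-j}` this would put `(τ - 1)^{i-1}` into `A_i`. It identifies the kernel of `(τ
- 1)^{i-j}` on `A/A_i` for the duality argument. -/
theorem mem_subA_of_pow_mul_mem (hσ : ∀ g : G, g ∈ Subgroup.zpowers σ) (hord : orderOf σ = p)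
    {i j : ℕ} (hij : j ≤ i) (hip : i ≤ p) {x : A} (hx : augGen p σ ^ (i - j) * x ∈ subA p σ i) :
    x ∈ subA p σ j := by
  by_contra h
  obtain ⟨k, c, hc, h⟩ := exists_pow_mul_sub_mem hσ h
  by_cases hj : j = 0
  · subst hj
    exact ‹x ∉ _› (mem_subA_iff.2 ⟨x, by simp⟩)
  obtain ⟨a, ha⟩ := mem_subA_iff.1 h
  obtain ⟨b, hb⟩ := mem_subA_iff.1 hx
  apply augGen_pow_pred_notMem hord (p := p) (i := i) (by omega) hip
  have e1 : i - j + (j - 1) = i - 1 := by omega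
  have e2 : j + (i - j) = i := by omega
  have hc' : augGen p σ ^ (i - 1) = c⁻¹ • (c • (augGen p σ ^ (i - 1))) := by
    rw [smul_smul, inv_mul_cancel₀ hc, one_smul]
  have h3 : c • augGen p σ ^ (i - 1) = (augGen p σ ^ k * b - a) * augGen p σ ^ i := by
    have h4 : augGen p σ ^ (i - j) * (augGen p σ ^ k * x) =
        augGen p σ ^ k * (augGen p σ ^ (i - j) * x) := by
      rw [← mul_assoc, ← pow_add, add_comm, pow_add, mul_assoc]
    have h5 : augGen p σ ^ (i - j) * (a * augGen p σ ^ j) = a * augGen p σ ^ i := by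
      rw [((commute_augGen hσ _).pow_left _).eq, mul_assoc, ← pow_add, e2]
    rw [sub_mul, mul_assoc, ← hb, ← h4, ← h5, ← mul_sub, ← ha, sub_sub_cancel, mul_smul_comm,
      ← pow_add, e1]
  rw [hc', h3]
  exact mem_subA_iff.2 ⟨c⁻¹ • (augGen p σ ^ k * b - a), by rw [smul_mul_assoc]⟩

/-- The submodule `A_i` does not depend on the choice between `σ` and `σ⁻¹`. -/
theorem subA_inv_le (hσ : ∀ g : G, g ∈ Subgroup.zpowers σ) (i : ℕ) :
    subA p σ⁻¹ i ≤ subA p σ i := by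
  intro x hx
  obtain ⟨a, rfl⟩ := mem_subA_iff.1 hx
  have h : augGen p σ⁻¹ = -MonoidAlgebra.of (ZMod p) G σ⁻¹ * augGen p σ := by
    rw [augGen, augGen, mul_sub, neg_mul, neg_mul, ← map_mul, inv_mul_cancel, map_one, mul_one]
    abel
  rw [h, (commute_augGen hσ _).symm.mul_pow, ← mul_assoc]
  exact mul_augGen_pow_mem _ _

theorem subA_inv (hσ : ∀ g : G, g ∈ Subgroup.zpowers σ) (i : ℕ) :
    subA p σ⁻¹ i = subA p σ i := by
  refine le_antisymm (subA_inv_le hσ i) ?_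
  have h := subA_inv_le (p := p) (σ := σ⁻¹) (fun g => by rw [Subgroup.zpowers_inv]; exact hσ g) i
  rwa [inv_inv] at h

end GroupAlgebra

/-! ### Powers of `ρ` and norms on unit groups -/

section RhoPow

variable {F Ω : Type*} [Field F] [Field Ω] [Algebra F Ω] {E : IntermediateField F Ω}
  (s : E ≃ₐ[F] E)

/-- The action of an automorphism on the group of units. -/
def unitsAct : Eˣ →* Eˣ := Units.map (s : E →* E)

@[simp] theorem coe_unitsAct (u : Eˣ) : (unitsAct s u : E) = s u := rfl

theorem rhoPow_zero (u : Eˣ) : rhoPow s 0 u = u := rfl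

theorem rhoPow_one_apply (u : Eˣ) : rhoPow s 1 u = unitsAct s u / u := rfl

theorem rhoPow_add (m n : ℕ) (u : Eˣ) : rhoPow s (m + n) u = rhoPow s m (rhoPow s n u) :=
  Function.iterate_add_apply _ m n u

theorem rhoPow_succ (k : ℕ) (u : Eˣ) :
    rhoPow s (k + 1) u = unitsAct s (rhoPow s k u) / rhoPow s k u := by
  rw [add_comm, rhoPow_add, rhoPow_one_apply]

theorem rhoPow_succ' (k : ℕ) (u : Eˣ) :
    rhoPow s (k + 1) u = rhoPow s k (unitsAct s u / u) := by
  rw [rhoPow_add, rhoPow_one_apply]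

theorem rhoPow_mul (k : ℕ) (u v : Eˣ) : rhoPow s k (u * v) = rhoPow s k u * rhoPow s k v := by
  induction k with
  | zero => rfl
  | succ k ih => rw [rhoPow_succ, rhoPow_succ, rhoPow_succ, ih, map_mul, mul_div_mul_comm]

theorem rhoPow_one (k : ℕ) : rhoPow s k 1 = 1 := by
  induction k with
  | zero => rfl
  | succ k ih => rw [rhoPow_succ, ih, map_one, div_one]

/-- `rhoPow` as a group homomorphism. -/
def rhoPowHom (k : ℕ) : Eˣ →* Eˣ where
  toFun := rhoPow s k
  map_one' := rhoPow_one s k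
  map_mul' := rhoPow_mul s k

theorem rhoPow_pow (k n : ℕ) (u : Eˣ) : rhoPow s k (u ^ n) = rhoPow s k u ^ n :=
  map_pow (rhoPowHom s k) u n

theorem rhoPow_div (k : ℕ) (u v : Eˣ) : rhoPow s k (u / v) = rhoPow s k u / rhoPow s k v :=
  map_div (rhoPowHom s k) u v

theorem unitsAct_rhoPow (k : ℕ) (u : Eˣ) :
    unitsAct s (rhoPow s k u) = rhoPow s (k + 1) u * rhoPow s k u := by
  rw [rhoPow_succ, div_mul_cancel]

/-- An element of `F` viewed as a unit of `E`. -/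
def baseUnit (E : IntermediateField F Ω) : Fˣ →* Eˣ := Units.map (algebraMap F E : F →* E)

@[simp] theorem coe_baseUnit (f : Fˣ) : (baseUnit E f : E) = algebraMap F E f := rfl

@[simp] theorem unitsAct_baseUnit (f : Fˣ) : unitsAct s (baseUnit E f) = baseUnit E f := by
  ext; simp

theorem rhoPow_succ_baseUnit (k : ℕ) (f : Fˣ) : rhoPow s (k + 1) (baseUnit E f) = 1 := by
  rw [rhoPow_succ', unitsAct_baseUnit, div_self', rhoPow_one]

theorem rhoPow_baseUnit {k : ℕ} (hk : 1 ≤ k) (f : Fˣ) : rhoPow s k (baseUnit E f) = 1 := by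
  obtain ⟨k, rfl⟩ := Nat.exists_eq_add_of_le' hk
  exact rhoPow_succ_baseUnit s k f

theorem rhoPow_baseUnit_mul {k : ℕ} (hk : 1 ≤ k) (f : Fˣ) (u : Eˣ) :
    rhoPow s k (baseUnit E f * u) = rhoPow s k u := by
  rw [rhoPow_mul, rhoPow_baseUnit s hk, one_mul]

/-- The product `u · s(u) ⋯ s^{n-1}(u)`. -/
def orbitProd (n : ℕ) : Eˣ →* Eˣ := ∏ k ∈ Finset.range n, unitsAct (s ^ k)

theorem orbitProd_apply (n : ℕ) (u : Eˣ) :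
    orbitProd s n u = ∏ k ∈ Finset.range n, unitsAct (s ^ k) u := by
  simp [orbitProd]

theorem unitsAct_mul (t : E ≃ₐ[F] E) (u : Eˣ) :
    unitsAct (s * t) u = unitsAct s (unitsAct t u) := rfl

@[simp] theorem unitsAct_one (u : Eˣ) : unitsAct (1 : E ≃ₐ[F] E) u = u := rfl

theorem unitsAct_orbitProd (n : ℕ) (u : Eˣ) :
    unitsAct s (orbitProd s n u) * u = unitsAct (s ^ n) u * orbitProd s n u := by
  have h : unitsAct s (orbitProd s n u) = ∏ k ∈ Finset.range n, unitsAct (s ^ (k + 1)) u := by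
    rw [orbitProd_apply, map_prod]
    refine Finset.prod_congr rfl fun k _ => ?_
    rw [pow_succ', unitsAct_mul]
  rw [h, mul_comm (unitsAct (s ^ n) u), orbitProd_apply, ← Finset.prod_range_succ,
    Finset.prod_range_succ' (fun k => unitsAct (s ^ k) u), pow_zero, unitsAct_one]

/-- A telescoping product. For `n = p` it measures how far `s^p` is from fixing `u`, and shows that
norms from `K` are fixed by `σ`. -/
theorem unitsAct_pow_div (n : ℕ) (u : Eˣ) :
    unitsAct (s ^ n) u / u = unitsAct s (orbitProd s n u) / orbitProd s n u := by
  rw [div_eq_div_iff_mul_eq_mul, unitsAct_orbitProd, mul_comm]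

theorem orbitProd_baseUnit (n : ℕ) (f : Fˣ) : orbitProd s n (baseUnit E f) = baseUnit E f ^ n := by
  rw [orbitProd_apply]; simp

theorem orbitProd_div_eq_one {n : ℕ} (hs : s ^ n = 1) (u : Eˣ) :
    orbitProd s n (unitsAct s u / u) = 1 := by
  have h := unitsAct_pow_div s n u
  rw [hs, unitsAct_one, div_self', eq_comm, div_eq_one] at h
  have h2 : orbitProd s n (unitsAct s u) = unitsAct s (orbitProd s n u) := by
    rw [orbitProd_apply, orbitProd_apply, map_prod]
    refine Finset.prod_congr rfl fun k _ => ?_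
    rw [← unitsAct_mul, ← unitsAct_mul, ← pow_succ, ← pow_succ']
  rw [map_div, div_eq_one, h2, h]

theorem orbitProd_rhoPow_eq_one {n : ℕ} (hs : s ^ n = 1) {k : ℕ} (hk : 1 ≤ k) (u : Eˣ) :
    orbitProd s n (rhoPow s k u) = 1 := by
  obtain ⟨k, rfl⟩ := Nat.exists_eq_add_of_le' hk
  rw [rhoPow_succ, orbitProd_div_eq_one s hs]

/-- The action of `s` as an endomorphism of the `ℤ`-module of units. -/
def actEnd : Module.End ℤ (Additive Eˣ) := (MonoidHom.toAdditive (unitsAct s)).toIntLinearMap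

theorem actEnd_pow_apply (k : ℕ) (u : Eˣ) :
    (actEnd s ^ k) (Additive.ofMul u) = Additive.ofMul (unitsAct (s ^ k) u) := by
  induction k with
  | zero => rfl
  | succ k ih => rw [pow_succ', Module.End.mul_apply, ih, pow_succ']; rfl

theorem actEnd_sub_one_pow_apply (k : ℕ) (u : Eˣ) :
    ((actEnd s - 1) ^ k) (Additive.ofMul u) = Additive.ofMul (rhoPow s k u) := by
  induction k with
  | zero => rfl
  | succ k ih => rw [pow_succ', Module.End.mul_apply, ih, rhoPow_succ]; rfl

/-- The norm differs from `(s - 1)^{p-1}` by a `p`th power. -/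
theorem exists_orbitProd_eq {p : ℕ} (hp : p.Prime) (u : Eˣ) :
    ∃ v : Eˣ, orbitProd s p u = rhoPow s (p - 1) u * v ^ p := by
  obtain ⟨Q, hQ⟩ := exists_geom_sum_X_eq p hp
  -- The polynomial congruence is evaluated at `s` in the endomorphism ring of the unit group; the
  -- term divisible by `p` supplies the `p`th power.
  have h := congrArg (fun P => Polynomial.aeval (actEnd s) P (Additive.ofMul u)) hQ
  refine ⟨(Polynomial.aeval (actEnd s) Q (Additive.ofMul u)).toMul, ?_⟩
  simp only [map_sum, map_pow, Polynomial.aeval_X, map_add, map_mul, map_sub, map_one,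
    LinearMap.add_apply, LinearMap.sum_apply, actEnd_pow_apply, actEnd_sub_one_pow_apply] at h
  apply Additive.ofMul.injective
  rw [orbitProd_apply, ofMul_prod, h, ofMul_mul, map_natCast, map_natCast, Module.End.mul_apply,
    Module.End.natCast_apply, ofMul_pow]
  rfl

end RhoPow

/-! ### Hilbert 90 and descent along powers of `ρ` -/

section Descent

variable {F Ω : Type*} [Field F] [Field Ω] [Algebra F Ω]

/-- When `F` contains a primitive `p`th root of unity, so it does all those of an extension. -/
theorem exists_baseUnit_of_pow_eq_one {p : ℕ} (hp : 0 < p) (hξ : ∃ ξ : F, IsPrimitiveRoot ξ p)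
    {E : IntermediateField F Ω} {u : Eˣ} (hu : u ^ p = 1) :
    ∃ f : Fˣ, f ^ p = 1 ∧ u = baseUnit E f := by
  obtain ⟨ξ, hξ⟩ := hξ
  have := NeZero.of_pos hp
  have h := hξ.map_of_injective (algebraMap F E).injective
  obtain ⟨k, -, hk⟩ := h.eq_pow_of_pow_eq_one (ξ := (u : E))
    (by rw [← Units.val_pow_eq_pow_val, hu]; rfl)
  obtain ⟨z, rfl⟩ := hξ.isUnit hp.ne'
  have hz : z ^ p = 1 := Units.ext (by simpa using hξ.pow_eq_one)
  refine ⟨z ^ k, by rw [← pow_mul, mul_comm, pow_mul, hz, one_pow], Units.ext ?_⟩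
  rw [← hk, map_pow]; rfl

/-- Two elements with the same `p`th power differ by an element of `F`. -/
theorem exists_eq_baseUnit_mul_of_pow_eq {p : ℕ} (hp : 0 < p) (hξ : ∃ ξ : F, IsPrimitiveRoot ξ p)
    {E : IntermediateField F Ω} {u v : Eˣ} (h : u ^ p = v ^ p) :
    ∃ f : Fˣ, f ^ p = 1 ∧ u = baseUnit E f * v := by
  obtain ⟨f, hf, h⟩ := exists_baseUnit_of_pow_eq_one hp hξ (u := u / v)
    (by rw [div_pow, h, div_self'])
  exact ⟨f, hf, by rw [← h, div_mul_cancel]⟩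

/-- An automorphism that multiplies `u` by a `p`th root of unity of `F` multiplies its iterates
accordingly, so that `u ⋯ s^{p-1}(u) = u ^ p` for odd `p`. -/
theorem orbitProd_eq_pow {p : ℕ} (hp2 : Odd p) {E : IntermediateField F Ω} {s : E ≃ₐ[F] E}
    {u : Eˣ} {f : Fˣ} (hf : f ^ p = 1) (hu : unitsAct s u = baseUnit E f * u) :
    orbitProd s p u = u ^ p := by
  have h (k : ℕ) : unitsAct (s ^ k) u = baseUnit E f ^ k * u := by
    induction k with
    | zero => simp
    | succ k ih =>
      rw [pow_succ', unitsAct_mul, ih, map_mul, map_pow, unitsAct_baseUnit, hu, ← mul_assoc,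
        ← pow_succ]
  simp only [orbitProd_apply, h, Finset.prod_mul_distrib, Finset.prod_const, Finset.card_range]
  rw [Finset.prod_pow_eq_pow_sum]
  have h2 : p ∣ ∑ k ∈ Finset.range p, k := by
    obtain ⟨m, rfl⟩ := hp2
    rw [Finset.sum_range_id, Nat.add_sub_cancel, Nat.mul_div_assoc _ (dvd_mul_right 2 m)]
    exact dvd_mul_right _ _
  obtain ⟨m, hm⟩ := h2
  rw [hm, pow_mul, ← map_pow, hf, map_one, one_pow, one_mul]

/-- Linear independence of distinct automorphisms. -/
theorem exists_sum_mul_ne_zero {E : IntermediateField F Ω} {ι : Type*} [Fintype ι]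
    {e : ι → (E ≃ₐ[F] E)} (he : Function.Injective e) {a : ι → E} (ha : ∃ i, a i ≠ 0) :
    ∃ z : E, ∑ i, a i * e i z ≠ 0 := by
  by_contra! h
  have hli : LinearIndependent E (fun i => ((e i : E →* E) : E → E)) :=
    (linearIndependent_monoidHom E E).comp (fun i => (e i : E →* E))
      (fun i j hij => he (AlgEquiv.ext fun x => DFunLike.congr_fun hij x))
  obtain ⟨i, hi⟩ := ha
  refine hi (Fintype.linearIndependent_iff.1 hli a ?_ i)
  ext1 z
  simpa using h z

variable {K : IntermediateField F Ω} [IsGalois F K] {σ : K ≃ₐ[F] K}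

theorem orderOf_generator {p : ℕ} (hp : 0 < p) (hK : Module.finrank F K = p)
    (hσ : ∀ g : K ≃ₐ[F] K, g ∈ Subgroup.zpowers σ) : orderOf σ = p := by
  have : FiniteDimensional F K := FiniteDimensional.of_finrank_pos (hK ▸ hp)
  rw [orderOf_eq_card_of_forall_mem_zpowers hσ, IsGalois.card_aut_eq_finrank, hK]

theorem pow_eq_one_generator {p : ℕ} (hp : 0 < p) (hK : Module.finrank F K = p)
    (hσ : ∀ g : K ≃ₐ[F] K, g ∈ Subgroup.zpowers σ) : σ ^ p = 1 := by
  rw [← orderOf_dvd_iff_pow_eq_one, orderOf_generator hp hK hσ]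

theorem fixed_of_unitsAct_eq {p : ℕ} (hp : 0 < p) (hK : Module.finrank F K = p)
    (hσ : ∀ g : K ≃ₐ[F] K, g ∈ Subgroup.zpowers σ) {u : Kˣ} (hu : unitsAct σ u = u) :
    ∃ f : Fˣ, u = baseUnit K f := by
  have : FiniteDimensional F K := FiniteDimensional.of_finrank_pos (hK ▸ hp)
  have h : (u : K) ∈ Set.range (algebraMap F K) := by
    rw [IsGalois.mem_range_algebraMap_iff_fixed]
    intro g
    have h1 : σ ∈ MulAction.stabilizer (K ≃ₐ[F] K) (u : K) := congrArg Units.val hu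
    exact (Subgroup.zpowers_le.2 h1) (hσ g)
  obtain ⟨f, hf⟩ := h
  have hf0 : f ≠ 0 := by
    rintro rfl
    exact u.ne_zero (by rw [← hf, map_zero])
  exact ⟨Units.mk0 f hf0, Units.ext hf.symm⟩

/-- Hilbert's Theorem 90. -/
theorem exists_unitsAct_div_of_orbitProd_eq_one {p : ℕ} (hp : 0 < p)
    (hK : Module.finrank F K = p) (hσ : ∀ g : K ≃ₐ[F] K, g ∈ Subgroup.zpowers σ) {u : Kˣ}
    (hu : orbitProd σ p u = 1) : ∃ v : Kˣ, u = unitsAct σ v / v := by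
  have hord := orderOf_generator hp hK hσ
  have hinj : Function.Injective (fun k : Fin p => σ ^ (k : ℕ)) := fun a b h =>
    Fin.ext (pow_injOn_Iio_orderOf (by simp [hord]) (by simp [hord]) h)
  have := NeZero.of_pos hp
  obtain ⟨z, hz⟩ := exists_sum_mul_ne_zero hinj (a := fun k => (orbitProd σ k u : K))
    ⟨0, Units.ne_zero _⟩
  -- A Lagrange resolvent: it satisfies `u σ(y) = y`, so the required element is `y⁻¹`.
  set y : K := ∑ k : Fin p, (orbitProd σ k u : K) * (σ ^ (k : ℕ)) z with hy
  have hy2 : y = ∑ k ∈ Finset.range p, (orbitProd σ k u : K) * (σ ^ k) z :=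
    Fin.sum_univ_eq_sum_range (fun k => (orbitProd σ k u : K) * (σ ^ k) z) p
  have hstep (k : ℕ) : u * unitsAct σ (orbitProd σ k u) = orbitProd σ (k + 1) u := by
    rw [mul_comm, unitsAct_orbitProd, orbitProd_apply, orbitProd_apply, Finset.prod_range_succ,
      mul_comm]
  have h1 : (u : K) * σ y = y := by
    have e : (u : K) * σ y =
        ∑ k ∈ Finset.range p, (orbitProd σ (k + 1) u : K) * (σ ^ (k + 1)) z := by
      rw [hy2, map_sum, Finset.mul_sum]
      refine Finset.sum_congr rfl fun k _ => ?_
      rw [map_mul, ← hstep, ← mul_assoc, pow_succ']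
      rfl
    have e2 := Finset.sum_range_succ' (fun k => (orbitProd σ k u : K) * (σ ^ k) z) p
    rw [Finset.sum_range_succ, ← e, ← hy2, hu, pow_eq_one_generator hp hK hσ] at e2
    have e3 : orbitProd σ 0 u = 1 := by simp [orbitProd_apply]
    rw [e3, pow_zero] at e2
    exact (add_right_cancel e2).symm
  refine ⟨(Units.mk0 y hz)⁻¹, ?_⟩
  rw [map_inv, inv_div_inv, eq_div_iff_mul_eq']
  refine Units.ext ?_
  simpa [mul_comm] using h1

/-- If `δ` is killed by `(σ - 1)^{p-n}` modulo `p`th powers and its norm is a `p`th power in `F`,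
then `δ` lies in `Fˣ · Kˣ^{(σ-1)^n}`. -/
theorem exists_eq_baseUnit_mul_rhoPow {p : ℕ} (hp : p.Prime) (hp2 : 2 < p)
    (hξ : ∃ ξ : F, IsPrimitiveRoot ξ p) (hK : Module.finrank F K = p)
    (hσ : ∀ g : K ≃ₐ[F] K, g ∈ Subgroup.zpowers σ) {n : ℕ} (hn : 1 ≤ n) (hnp : n < p)
    {δ c : Kˣ} {f₀ : Fˣ} (hN : orbitProd σ p δ = baseUnit K f₀ ^ p)
    (hc : rhoPow σ (p - n) δ = c ^ p) :
    ∃ (f : Fˣ) (ω : Kˣ), δ = baseUnit K f * rhoPow σ n ω := by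
  induction n, hn using Nat.le_induction generalizing δ c f₀ with
  | base =>
    obtain ⟨η, hη⟩ := exists_unitsAct_div_of_orbitProd_eq_one hp.pos hK hσ
      (u := δ / baseUnit K f₀) (by rw [map_div, hN, orbitProd_baseUnit, div_self'])
    exact ⟨f₀, η, by rw [rhoPow_one_apply, ← hη, mul_div_cancel]⟩
  | succ n hn ih =>
    obtain ⟨η, hη⟩ := exists_unitsAct_div_of_orbitProd_eq_one hp.pos hK hσ
      (u := δ / baseUnit K f₀) (by rw [map_div, hN, orbitProd_baseUnit, div_self'])
    have hδ : δ = baseUnit K f₀ * rhoPow σ 1 η := by rw [rhoPow_one_apply, ← hη, mul_div_cancel]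
    have hη2 : rhoPow σ (p - n) η = c ^ p := by
      rw [← hc, hδ, rhoPow_baseUnit_mul σ (by omega), ← rhoPow_add]
      congr 1
      omega
    obtain ⟨v, hv⟩ := exists_orbitProd_eq σ hp η
    -- The norm is `ρ^{p-1}` up to a `p`th power, and `p - 1 = (n - 1) + (p - n)`, while
    -- `η^{ρ^{p-n}} = c^p`.
    obtain ⟨m, hm⟩ : ∃ m : Kˣ, orbitProd σ p η = m ^ p := by
      refine ⟨rhoPow σ (n - 1) c * v, ?_⟩
      rw [hv, mul_pow, ← rhoPow_pow, ← hη2, ← rhoPow_add]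
      congr 3
      omega
    have hσp := pow_eq_one_generator hp.pos hK hσ
    -- `m^p` is a norm, hence fixed by `σ`, so `σ(m)/m` is a root of unity `ζ` in `F`.
    have hm2 : unitsAct σ m ^ p = m ^ p := by
      rw [← map_pow, ← hm]
      have h := unitsAct_pow_div σ p η
      rw [hσp, unitsAct_one, div_self', eq_comm, div_eq_one] at h
      exact h
    obtain ⟨ζ, hζ, hmζ⟩ := exists_eq_baseUnit_mul_of_pow_eq hp.pos hξ hm2
    have hρm : rhoPow σ 1 m = baseUnit K ζ := by rw [rhoPow_one_apply, hmζ, mul_div_cancel_right]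
    have hNm := orbitProd_eq_pow (hp.odd_of_ne_two hp2.ne') hζ hmζ
    -- `N(m) = m^p = N(η)` for odd `p`, so `η/m` has norm `1`. Passing to `η/m` does not affect the
    -- other hypothesis, because `m^ρ = ζ` is killed by the remaining `p - n - 1 ≥ 1` factors `ρ`;
    -- it only costs the constant `ζ` in `δ`.
    obtain ⟨f, ω, h⟩ := ih (by omega) (δ := η / m) (c := c) (f₀ := 1)
      (by rw [map_div, hm, hNm, div_self', map_one, one_pow])
      (by
        have e : p - n = (p - n - 1) + 1 := by omega
        rw [rhoPow_div, hη2, e, rhoPow_add _ _ 1 m, hρm, rhoPow_baseUnit σ (by omega), div_one])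
    refine ⟨f₀ * ζ, ω, ?_⟩
    have h2 : rhoPow σ 1 (η / m) = rhoPow σ (n + 1) ω := by
      rw [h, rhoPow_baseUnit_mul σ le_rfl, ← rhoPow_add, add_comm]
    rw [hδ, map_mul, mul_assoc, ← h2, rhoPow_div, hρm, mul_div_cancel]

end Descent

/-! ### Restriction of automorphisms between intermediate fields -/

section Restriction

variable {F Ω : Type*} [Field F] [Field Ω] [Algebra F Ω]

/-- The inclusion of unit groups of intermediate fields. -/
def inclUnit {K E : IntermediateField F Ω} (h : K ≤ E) : Kˣ →* Eˣ :=
  Units.map (IntermediateField.inclusion h : K →* E)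

@[simp] theorem coe_inclUnit {K E : IntermediateField F Ω} (h : K ≤ E) (u : Kˣ) :
    (((inclUnit h u : Eˣ) : E) : Ω) = ((u : K) : Ω) := rfl

theorem inclUnit_injective {K E : IntermediateField F Ω} (h : K ≤ E) :
    Function.Injective (inclUnit h) :=
  Units.map_injective (IntermediateField.inclusion h).injective

theorem units_coe_injective {E : IntermediateField F Ω} {u v : Eˣ}
    (h : ((u : E) : Ω) = ((v : E) : Ω)) : u = v :=
  Units.ext (Subtype.ext h)

theorem inclUnit_baseUnit {K E : IntermediateField F Ω} (h : K ≤ E) (f : Fˣ) :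
    inclUnit h (baseUnit K f) = baseUnit E f := units_coe_injective rfl

theorem exists_inclUnit_eq {K E : IntermediateField F Ω} (h : K ≤ E) {u : Eˣ}
    (hu : ((u : E) : Ω) ∈ K) : ∃ v : Kˣ, inclUnit h v = u := by
  have h0 : (⟨_, hu⟩ : K) ≠ 0 := fun h0 => u.ne_zero (Subtype.ext (congrArg (Subtype.val) h0 :))
  exact ⟨Units.mk0 _ h0, units_coe_injective rfl⟩

theorem IsRestriction.unitsAct_inclUnit {K E : IntermediateField F Ω} (h : K ≤ E)
    {s : E ≃ₐ[F] E} {σ : K ≃ₐ[F] K} (hs : IsRestriction s σ) (u : Kˣ) :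
    unitsAct s (inclUnit h u) = inclUnit h (unitsAct σ u) :=
  units_coe_injective (hs u (h (u : K).2) (u : K).2)

theorem IsRestriction.rhoPow_inclUnit {K E : IntermediateField F Ω} (h : K ≤ E)
    {s : E ≃ₐ[F] E} {σ : K ≃ₐ[F] K} (hs : IsRestriction s σ) (k : ℕ) (u : Kˣ) :
    rhoPow s k (inclUnit h u) = inclUnit h (rhoPow σ k u) := by
  induction k with
  | zero => rfl
  | succ k ih => rw [rhoPow_succ, rhoPow_succ, ih, hs.unitsAct_inclUnit h, map_div]

theorem IsRestriction.orbitProd_inclUnit {K E : IntermediateField F Ω} (h : K ≤ E)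
    {s : E ≃ₐ[F] E} {σ : K ≃ₐ[F] K} (hs : IsRestriction s σ) (n : ℕ) (u : Kˣ) :
    orbitProd s n (inclUnit h u) = inclUnit h (orbitProd σ n u) := by
  rw [orbitProd_apply, orbitProd_apply, map_prod]
  refine Finset.prod_congr rfl fun k hk => ?_
  clear hk
  induction k with
  | zero => rfl
  | succ k ih => rw [pow_succ', unitsAct_mul, ih, hs.unitsAct_inclUnit h, pow_succ']; rfl

theorem exists_isRestriction {M E : IntermediateField F Ω} (h : M ≤ E) [Normal F M]
    (g : E ≃ₐ[F] E) : ∃ g' : M ≃ₐ[F] M, IsRestriction g g' := by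
  let := (IntermediateField.inclusion h).toAlgebra
  have : IsScalarTower F M E := IsScalarTower.of_algebraMap_eq fun x => rfl
  exact ⟨g.restrictNormal M, fun x _ hx =>
    (congrArg Subtype.val (g.restrictNormal_commutes M ⟨x, hx⟩)).symm⟩

theorem exists_isRestriction_lift {M E : IntermediateField F Ω} (h : M ≤ E) [Normal F E]
    (g' : M ≃ₐ[F] M) : ∃ g : E ≃ₐ[F] E, IsRestriction g g' := by
  let := (IntermediateField.inclusion h).toAlgebra
  have : IsScalarTower F M E := IsScalarTower.of_algebraMap_eq fun x => rfl
  exact ⟨g'.liftNormal E, fun x _ hx =>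
    congrArg Subtype.val (g'.liftNormal_commutes E ⟨x, hx⟩)⟩

theorem IsRestriction.unique {M E : IntermediateField F Ω} (h : M ≤ E) {g : E ≃ₐ[F] E}
    {g₁ g₂ : M ≃ₐ[F] M} (h₁ : IsRestriction g g₁) (h₂ : IsRestriction g g₂) : g₁ = g₂ :=
  AlgEquiv.ext fun x => Subtype.ext ((h₁ x (h x.2) x.2).symm.trans (h₂ x (h x.2) x.2))

theorem IsRestriction.mul {M E : IntermediateField F Ω} (h : M ≤ E) {g₁ g₂ : E ≃ₐ[F] E}
    {h₁ h₂ : M ≃ₐ[F] M} (e₁ : IsRestriction g₁ h₁) (e₂ : IsRestriction g₂ h₂) :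
    IsRestriction (g₁ * g₂) (h₁ * h₂) := by
  intro x hE hM
  have e : g₂ ⟨x, hE⟩ = ⟨h₂ ⟨x, hM⟩, h (h₂ ⟨x, hM⟩).2⟩ := Subtype.ext (e₂ x hE hM)
  rw [AlgEquiv.mul_apply, e]
  exact e₁ _ _ (h₂ ⟨x, hM⟩).2

theorem IsRestriction.one {M E : IntermediateField F Ω} :
    IsRestriction (1 : E ≃ₐ[F] E) (1 : M ≃ₐ[F] M) := fun _ _ _ => rfl

theorem IsRestriction.trans {K M E : IntermediateField F Ω} (h : K ≤ M) (h' : M ≤ E)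
    {g : E ≃ₐ[F] E} {g₁ : M ≃ₐ[F] M} {g₂ : K ≃ₐ[F] K} (h₁ : IsRestriction g g₁)
    (h₂ : IsRestriction g₁ g₂) : IsRestriction g g₂ := fun x _ hK =>
  (h₁ x (h' (h hK)) (h hK)).trans (h₂ x (h hK) hK)

theorem IsRestriction.of_trans {K M E : IntermediateField F Ω} (h : K ≤ M) (h' : M ≤ E)
    {g : E ≃ₐ[F] E} {g₁ : M ≃ₐ[F] M} {g₂ : K ≃ₐ[F] K} (h₁ : IsRestriction g g₁)
    (h₂ : IsRestriction g g₂) : IsRestriction g₁ g₂ := fun x _ hK =>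
  (h₁ x (h' (h hK)) (h hK)).symm.trans (h₂ x (h' (h hK)) hK)

/-- Restriction of automorphisms to a normal subextension. -/
noncomputable def resHom {M E : IntermediateField F Ω} (h : M ≤ E) [Normal F M] :
    (E ≃ₐ[F] E) →* (M ≃ₐ[F] M) :=
  MonoidHom.mk' (fun g => (exists_isRestriction h g).choose) fun g₁ g₂ =>
    (exists_isRestriction h (g₁ * g₂)).choose_spec.unique h
      ((exists_isRestriction h g₁).choose_spec.mul h (exists_isRestriction h g₂).choose_spec)

theorem isRestriction_resHom {M E : IntermediateField F Ω} (h : M ≤ E) [Normal F M]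
    (g : E ≃ₐ[F] E) : IsRestriction g (resHom h g) :=
  (exists_isRestriction h g).choose_spec

theorem resHom_eq_iff {M E : IntermediateField F Ω} (h : M ≤ E) [Normal F M]
    {g : E ≃ₐ[F] E} {g' : M ≃ₐ[F] M} : resHom h g = g' ↔ IsRestriction g g' :=
  ⟨fun e => e ▸ isRestriction_resHom h g, fun e => (isRestriction_resHom h g).unique h e⟩

theorem resHom_surjective {M E : IntermediateField F Ω} (h : M ≤ E) [Normal F M] [Normal F E] :
    Function.Surjective (resHom h) := fun g' =>
  (exists_isRestriction_lift h g').imp fun _ => (resHom_eq_iff h).2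

/-- An element of a Galois extension `E` fixed by `Gal(E/K)` lies in `K`. -/
theorem mem_of_fixed {K E : IntermediateField F Ω} (h : K ≤ E) [IsGalois F E] {x : E}
    (hx : ∀ g : E ≃ₐ[F] E, IsRestriction g (1 : K ≃ₐ[F] K) → g x = x) : (x : Ω) ∈ K := by
  have h1 := InfiniteGalois.fixedField_fixingSubgroup (IntermediateField.restrict h)
  have h2 : x ∈ IntermediateField.fixedField (IntermediateField.restrict h).fixingSubgroup := by
    intro g
    refine hx g.1 fun y hE hK => ?_
    exact congrArg Subtype.val
      (g.2 ⟨⟨y, hE⟩, (IntermediateField.mem_restrict h ⟨y, hE⟩).2 hK⟩)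
  rw [h1] at h2
  exact (IntermediateField.mem_restrict h x).1 h2

end Restriction

/-- `K / F` is cyclic of odd prime degree `p`, with Galois group generated by `σ`, and `F` contains
a primitive `p`th root of unity. -/
structure IsCyclicKummer (p : ℕ) {F Ω : Type*} [Field F] [Field Ω] [Algebra F Ω]
    {K : IntermediateField F Ω} (σ : K ≃ₐ[F] K) : Prop where
  prime : p.Prime
  two_lt : 2 < p
  exists_root : ∃ ξ : F, IsPrimitiveRoot ξ p
  finrank_eq : Module.finrank F K = p
  generates : ∀ g : K ≃ₐ[F] K, g ∈ Subgroup.zpowers σ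

/-! ### Fields generated over `K` by `p`th roots of conjugates -/

section KummerField

variable {p : ℕ} {F Ω : Type*} [Field F] [Field Ω] [Algebra F Ω] {K : IntermediateField F Ω}

/-- `u` has a `p`th root in `E`. -/
def HasRoot (p : ℕ) {K : IntermediateField F Ω} (E : IntermediateField F Ω) (u : Kˣ) : Prop :=
  ∃ x ∈ E, x ^ p = ((u : K) : Ω)

theorem HasRoot.mono {E E' : IntermediateField F Ω} (h : E ≤ E') {u : Kˣ} (hu : HasRoot p E u) :
    HasRoot p E' u := by
  obtain ⟨x, hx, e⟩ := hu
  exact ⟨x, h hx, e⟩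

theorem HasRoot.mul {E : IntermediateField F Ω} {u v : Kˣ} (hu : HasRoot p E u)
    (hv : HasRoot p E v) : HasRoot p E (u * v) := by
  obtain ⟨x, hx, hx2⟩ := hu
  obtain ⟨y, hy, hy2⟩ := hv
  exact ⟨x * y, mul_mem hx hy, by simp [mul_pow, hx2, hy2]⟩

theorem HasRoot.pow {E : IntermediateField F Ω} (h : K ≤ E) (u : Kˣ) : HasRoot p E (u ^ p) :=
  ⟨(u : K), h (u : K).2, by simp⟩

theorem HasRoot.exists_unit {E : IntermediateField F Ω} (hp : 0 < p) (h : K ≤ E) {u : Kˣ}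
    (hu : HasRoot p E u) : ∃ y : Eˣ, y ^ p = inclUnit h u := by
  obtain ⟨x, hx, e⟩ := hu
  have hx0 : x ≠ 0 := by
    rintro rfl
    rw [zero_pow hp.ne'] at e
    exact u.ne_zero (Subtype.ext e.symm)
  exact ⟨Units.mk0 ⟨x, hx⟩ fun h0 => hx0 (congrArg Subtype.val h0),
    units_coe_injective (by simpa using e)⟩

theorem hasRoot_of_unit {E : IntermediateField F Ω} (h : K ≤ E) {u : Kˣ} {y : Eˣ}
    (hy : y ^ p = inclUnit h u) : HasRoot p E u :=
  ⟨(y : E), (y : E).2, by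
    rw [← coe_inclUnit h, ← hy]
    simp⟩

/-- The `p`th roots of unity lie in `F`, so one root in `E` brings all the others. -/
theorem HasRoot.mem (hp : 0 < p) (hξ : ∃ ξ : F, IsPrimitiveRoot ξ p) {E : IntermediateField F Ω}
    {u : Kˣ} (hu : HasRoot p E u) {x : Ω} (hx : x ^ p = ((u : K) : Ω)) : x ∈ E := by
  obtain ⟨ξ, hξ⟩ := hξ
  obtain ⟨y, hy, e⟩ := hu
  have hy0 : y ≠ 0 := by
    rintro rfl
    rw [zero_pow hp.ne'] at e
    exact u.ne_zero (Subtype.ext e.symm)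
  have := NeZero.of_pos hp
  obtain ⟨k, -, hk⟩ := (hξ.map_of_injective (algebraMap F Ω).injective).eq_pow_of_pow_eq_one
    (ξ := x / y) (by rw [div_pow, hx, e, div_self (e ▸ pow_ne_zero p hy0)])
  rw [eq_div_iff hy0] at hk
  rw [← hk]
  exact mul_mem (pow_mem (algebraMap_mem E ξ) k) hy

variable {σ : K ≃ₐ[F] K}

theorem HasRoot.rhoPow {E : IntermediateField F Ω} [Normal F E] (hp : 0 < p) (h : K ≤ E) {u : Kˣ}
    (hu : HasRoot p E u) (k : ℕ) : HasRoot p E (rhoPow σ k u) := by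
  obtain ⟨s, hs⟩ := exists_isRestriction_lift h σ
  obtain ⟨y, hy⟩ := hu.exists_unit hp h
  exact hasRoot_of_unit h (y := GaloisModuleEmbedding.rhoPow s k y)
    (by rw [← rhoPow_pow, hy, hs.rhoPow_inclUnit h])

variable (p σ) in
/-- The field obtained from `K` by adjoining the `p`th roots of all conjugates of `δ`. -/
def kummerField (δ : Kˣ) : IntermediateField F Ω :=
  K ⊔ IntermediateField.adjoin F {x : Ω | ∃ k : ℕ, x ^ p = ((rhoPow σ k δ : K) : Ω)}

theorem le_kummerField (δ : Kˣ) : K ≤ kummerField p σ δ := le_sup_left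

theorem mem_kummerField {δ : Kˣ} {k : ℕ} {x : Ω} (hx : x ^ p = ((rhoPow σ k δ : K) : Ω)) :
    x ∈ kummerField p σ δ :=
  le_sup_right (a := K) (IntermediateField.subset_adjoin F _ ⟨k, hx⟩)

theorem hasRoot_kummerField [IsAlgClosed Ω] (hp : 0 < p) (δ : Kˣ) (k : ℕ) :
    HasRoot p (kummerField p σ δ) (rhoPow σ k δ) := by
  obtain ⟨x, hx⟩ := IsAlgClosed.exists_pow_nat_eq ((rhoPow σ k δ : K) : Ω) hp
  exact ⟨x, mem_kummerField hx, hx⟩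

theorem kummerField_le (hp : 0 < p) (hξ : ∃ ξ : F, IsPrimitiveRoot ξ p)
    {E : IntermediateField F Ω} (h : K ≤ E) {δ : Kˣ} (hδ : ∀ k, HasRoot p E (rhoPow σ k δ)) :
    kummerField p σ δ ≤ E := by
  refine sup_le h (IntermediateField.adjoin_le_iff.2 ?_)
  rintro x ⟨k, hx⟩
  exact (hδ k).mem hp hξ hx

theorem kummerField_le_of_normal (hp : 0 < p) (hξ : ∃ ξ : F, IsPrimitiveRoot ξ p)
    {E : IntermediateField F Ω} [Normal F E] (h : K ≤ E) {δ : Kˣ} (hδ : HasRoot p E δ) :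
    kummerField p σ δ ≤ E :=
  kummerField_le hp hξ h fun k => hδ.rhoPow hp h k

/-- It suffices to look at generators: `f` maps `K` into itself by normality, and the elements of
`S` into `E` by assumption. -/
theorem fieldRange_le {R E : IntermediateField F Ω} {S : Set Ω}
    (hR : R = K ⊔ IntermediateField.adjoin F S) [Normal F K] (hKE : K ≤ E) (f : R →ₐ[F] Ω)
    (hS : ∀ x ∈ S, ∀ hx : x ∈ R, f ⟨x, hx⟩ ∈ E) : f.fieldRange ≤ E := by
  have hKR : K ≤ R := hR ▸ le_sup_left
  have h1 : R ≤ IntermediateField.lift (E.comap f) := by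
    conv_lhs => rw [hR]
    refine sup_le (fun x hx => ?_) (IntermediateField.adjoin_le_iff.2 fun x hx => ?_)
    · refine (IntermediateField.mem_lift (E := E.comap f) ⟨x, hKR hx⟩).2 (hKE ?_)
      rw [AlgHom.coe_toRingHom]
      have h2 := (f.comp (IntermediateField.inclusion hKR)).restrictNormal_commutes K ⟨x, hx⟩
      exact h2 ▸ SetLike.coe_mem _
    · have hxR : x ∈ R := by
        rw [hR]
        exact le_sup_right (a := K) (IntermediateField.subset_adjoin F _ hx)
      exact (IntermediateField.mem_lift (E := E.comap f) ⟨x, hxR⟩).2 (hS x hx hxR)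
  rintro _ ⟨x, rfl⟩
  exact (IntermediateField.mem_lift x).1 (h1 x.2)

/-- The existence of a primitive `p`th root of unity makes `p` nonzero in `K`, so `X^p - u` is
separable. -/
theorem isSeparable_of_pow_eq (hp : 0 < p) (hξ : ∃ ξ : F, IsPrimitiveRoot ξ p)
    [IsGalois F K] {u : Kˣ} {x : Ω} (hx : x ^ p = ((u : K) : Ω)) : IsSeparable F x := by
  obtain ⟨ξ, hξ⟩ := hξ
  have := NeZero.of_pos hp
  have hpK : ((p : ℕ) : K) ≠ 0 := by
    have := (hξ.map_of_injective (algebraMap F K).injective).neZero'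
    exact this.out
  refine IsSeparable.of_algebra_isSeparable_of_isSeparable F (E := K) ?_
  refine (Polynomial.separable_X_pow_sub_C (u : K) hpK u.ne_zero).of_dvd (minpoly.dvd K x ?_)
  simp [hx]

theorem isSeparable_sup_adjoin (hp : 0 < p) (hξ : ∃ ξ : F, IsPrimitiveRoot ξ p)
    [IsGalois F K] {S : Set Ω} (hS : ∀ x ∈ S, ∃ u : Kˣ, x ^ p = ((u : K) : Ω)) :
    Algebra.IsSeparable F ↥(K ⊔ IntermediateField.adjoin F S) := by
  have : Algebra.IsSeparable F (IntermediateField.adjoin F S) :=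
    (IntermediateField.isSeparable_adjoin_iff_isSeparable F Ω).2 fun x hx =>
      (hS x hx).elim fun u hu => isSeparable_of_pow_eq hp hξ hu
  exact IntermediateField.isSeparable_sup F Ω K _

theorem normal_of_fieldRange_le [IsAlgClosed Ω] {E : IntermediateField F Ω}
    [Algebra.IsAlgebraic F E] (h : ∀ f : E →ₐ[F] Ω, f.fieldRange ≤ E) : Normal F E := by
  refine normal_iff.2 fun x => ⟨Algebra.IsIntegral.isIntegral x, ?_⟩
  refine IntermediateField.splits_of_splits (IsAlgClosed.splits _) fun y hy => ?_
  obtain ⟨f, rfl⟩ := IntermediateField.exists_algHom_of_splits_of_aeval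
    (fun x : E => ⟨Algebra.IsIntegral.isIntegral x, IsAlgClosed.splits _⟩)
    (Polynomial.mem_rootSet.1 hy).2
  exact h f ⟨x, rfl⟩

/-- Induction on the exponent of `τ = σ^m`, using `σ(δ^{ρ^k}) = δ^{ρ^{k+1}} δ^{ρ^k}`. -/
theorem hasRoot_kummerField_apply [IsAlgClosed Ω] (hC : IsCyclicKummer p σ) (δ : Kˣ) (k : ℕ)
    (τ : K ≃ₐ[F] K) : HasRoot p (kummerField p σ δ) (unitsAct τ (rhoPow σ k δ)) := by
  have : FiniteDimensional F K :=
    FiniteDimensional.of_finrank_pos (hC.finrank_eq ▸ hC.prime.pos)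
  obtain ⟨m, rfl⟩ := (Submonoid.mem_powers_iff τ σ).1
    ((mem_powers_iff_mem_zpowers (x := σ)).2 (hC.generates τ))
  induction m generalizing k with
  | zero => exact hasRoot_kummerField hC.prime.pos δ k
  | succ m ih =>
    rw [pow_succ, unitsAct_mul, unitsAct_rhoPow, map_mul]
    exact (ih (k + 1)).mul (ih k)

theorem powerClasses_eq_iff {u v : Kˣ} :
    (u : PowerClasses p K) = (v : PowerClasses p K) ↔ ∃ c : Kˣ, v = u * c ^ p := by
  rw [QuotientGroup.eq]
  refine exists_congr fun c => ?_
  rw [powMonoidHom_apply, eq_inv_mul_iff_mul_eq, eq_comm]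

variable [IsGalois F K]

/-- An embedding maps a root of `u ∈ K` to a root of a conjugate of `u`. -/
theorem exists_pow_eq_unitsAct {R : IntermediateField F Ω} (h : K ≤ R) (f : R →ₐ[F] Ω) :
    ∃ τ : K ≃ₐ[F] K, ∀ (u : Kˣ) (x : R), (x : Ω) ^ p = ((u : K) : Ω) →
      f x ^ p = ((unitsAct τ u : K) : Ω) := by
  refine ⟨(f.comp (IntermediateField.inclusion h)).restrictNormal' K, fun u x hx => ?_⟩
  have e : x ^ p = IntermediateField.inclusion h u := Subtype.ext (by simpa using hx)
  rw [← map_pow, e]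
  exact ((f.comp (IntermediateField.inclusion h)).restrictNormal_commutes K u).symm

theorem isGalois_kummerField [IsAlgClosed Ω] (hC : IsCyclicKummer p σ) (δ : Kˣ) :
    IsGalois F (kummerField p σ δ) := by
  have : Algebra.IsSeparable F (kummerField p σ δ) :=
    isSeparable_sup_adjoin hC.prime.pos hC.exists_root fun x ⟨k, hx⟩ => ⟨_, hx⟩
  refine isGalois_iff.2 ⟨this, normal_of_fieldRange_le fun f => ?_⟩
  refine fieldRange_le rfl (le_kummerField δ) f ?_
  rintro x ⟨k, hx⟩ hxE
  obtain ⟨τ, hτ⟩ := exists_pow_eq_unitsAct (p := p) (le_kummerField δ) f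
  exact (hasRoot_kummerField_apply hC δ k τ).mem hC.prime.pos hC.exists_root (hτ _ ⟨x, hxE⟩ hx)

/-- Embeddings send roots of `γ` to roots of its conjugates, which gives one inclusion; the other
holds because a normal field with one root of `γ` has roots of all `γ^{ρ^k}`. It replaces `L` by a
field with explicit generators. -/
theorem normalClosure_rootField [IsAlgClosed Ω] (hC : IsCyclicKummer p σ) (γ : Kˣ) :
    IntermediateField.normalClosure F (rootField p γ) Ω = kummerField p σ γ := by
  have hp := hC.prime.pos
  apply le_antisymm
  · refine iSup_le fun f => fieldRange_le rfl (le_kummerField γ) f ?_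
    intro x hx hxE
    obtain ⟨τ, hτ⟩ := exists_pow_eq_unitsAct (p := p) (le_sup_left : K ≤ rootField p γ) f
    exact (hasRoot_kummerField_apply hC γ 0 τ).mem hp hC.exists_root (hτ _ ⟨x, hxE⟩ hx)
  · have : Algebra.IsSeparable F (rootField p γ) :=
      isSeparable_sup_adjoin hp hC.exists_root fun x hx => ⟨_, hx⟩
    have hle := IntermediateField.le_normalClosure (rootField p γ)
    have : Normal F (IntermediateField.normalClosure F (rootField p γ) Ω) :=
      (Algebra.IsAlgebraic.isNormalClosure_normalClosure
        (fun x => IsAlgClosed.splits _)).normal (K := rootField p γ)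
    refine kummerField_le_of_normal hp hC.exists_root (le_sup_left.trans hle) ?_
    obtain ⟨x, hx⟩ := IsAlgClosed.exists_pow_nat_eq ((γ : K) : Ω) hp
    exact ⟨x, hle (le_sup_right (a := K) (IntermediateField.subset_adjoin F _ hx)), hx⟩

/-- The explicit solution field is generated by the `p`th roots of the conjugates of
`f ω^{ρ^{p-i}}`. -/
theorem solutionField_eq_kummerField [IsAlgClosed Ω] (hC : IsCyclicKummer p σ) {i j : ℕ}
    (hij : j < i) (hi : i ≤ p) {γ ω c : Kˣ} (hγ : rhoPow σ (p - j) ω = γ * c ^ p) (f : Fˣ) :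
    solutionField p σ i j (kummerField p σ γ) f ω =
      kummerField p σ (baseUnit K f * rhoPow σ (p - i) ω) := by
  have hp := hC.prime.pos
  set δ := baseUnit K f * rhoPow σ (p - i) ω with hδ
  have hδk {k : ℕ} (hk : 1 ≤ k) : rhoPow σ k δ = rhoPow σ (p - i + k) ω := by
    rw [hδ, rhoPow_baseUnit_mul σ hk, ← rhoPow_add, add_comm]
  have := isGalois_kummerField hC γ
  have := isGalois_kummerField hC δ
  apply le_antisymm
  · refine sup_le (kummerField_le_of_normal hp hC.exists_root (le_kummerField δ) ?_)
      (IntermediateField.adjoin_le_iff.2 ?_)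
    · have e : γ = rhoPow σ (i - j) δ * c⁻¹ ^ p := by
        rw [hδk (by omega), show p - i + (i - j) = p - j by omega, hγ, inv_pow,
          mul_inv_cancel_right]
      rw [e]
      exact (hasRoot_kummerField hp δ _).mul (HasRoot.pow (le_kummerField δ) _)
    · rintro x (hx | ⟨k, hk, -, hx⟩)
      · exact mem_kummerField (k := 0) hx
      · refine mem_kummerField (k := k - (p - i)) ?_
        rw [hδk (by omega), hx]
        congr 3
        omega
  -- For `k < i - j` the roots of `δ^{ρ^k}` are listed generators, and `f` occurs only for `k = 0`
  -- because `ρ` kills it. From `k = i - j` on, `δ^{ρ^k}` is a `γ^{ρ^m}` times a `p`th power, so its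
  -- roots are in `L` already.
  · have hKL : K ≤ kummerField p σ γ := le_kummerField γ
    have hL : kummerField p σ γ ≤ solutionField p σ i j (kummerField p σ γ) f ω := le_sup_left
    refine kummerField_le hp hC.exists_root (hKL.trans hL) fun k => ?_
    by_cases hk : k < i - j
    · obtain ⟨x, hx⟩ := IsAlgClosed.exists_pow_nat_eq ((rhoPow σ k δ : K) : Ω) hp
      refine ⟨x, le_sup_right (a := kummerField p σ γ) (IntermediateField.subset_adjoin F _ ?_), hx⟩
      rcases Nat.eq_zero_or_pos k with rfl | hk0
      · exact Or.inl hx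
      · exact Or.inr ⟨p - i + k, by omega, by omega, by rw [hx, hδk hk0]⟩
    · have e : rhoPow σ k δ = rhoPow σ (k - (i - j)) γ * rhoPow σ (k - (i - j)) c ^ p := by
        rw [hδk (by omega), ← rhoPow_pow, ← rhoPow_mul, ← hγ, ← rhoPow_add]
        congr 1
        omega
      rw [e]
      exact ((hasRoot_kummerField hp γ _).mono hL).mul (HasRoot.pow (hKL.trans hL) _)

end KummerField

/-! ### Orbit maps of modules over the group algebra -/

section ModuleAction

/-- An additive action of `G` on an `𝔽_p`-module makes it a module over `𝔽_p[G]`; this is the orbit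
map of an element. -/
theorem exists_orbit_map_of_module (p : ℕ) {G V : Type*} [Group G] [AddCommGroup V]
    [Module (ZMod p) V] (c : G →* AddMonoid.End V) (ν : V) :
    ∃ T : MonoidAlgebra (ZMod p) G →+ V, T 1 = ν ∧
      ∀ g a, T (MonoidAlgebra.of (ZMod p) G g * a) = c g (T a) := by
  let r : G →* Module.End (ZMod p) V :=
    { toFun := fun g => AddMonoidHom.toZModLinearMap p (c g)
      map_one' := by ext; simp; rfl
      map_mul' := fun g h => by ext; simp; rfl }
  refine ⟨(LinearMap.toAddMonoidHom (LinearMap.applyₗ (R := ZMod p) ν)).comp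
    (Representation.asAlgebraHom r).toLinearMap.toAddMonoidHom, ?_, fun g a => ?_⟩
  · simp
  · simp [r]
    rfl

theorem exists_orbit_map (p : ℕ) {G V : Type*} [Group G] [AddCommGroup V]
    (hV : ∀ x : V, p • x = 0) (c : G →* AddMonoid.End V) (ν : V) :
    ∃ T : MonoidAlgebra (ZMod p) G →+ V, T 1 = ν ∧
      ∀ g a, T (MonoidAlgebra.of (ZMod p) G g * a) = c g (T a) :=
  let _ : Module (ZMod p) V := AddCommGroup.zmodModule hV
  exists_orbit_map_of_module p c ν

end ModuleAction

/-! ### The Kummer pairing -/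

section Characters

variable {F Ω : Type*} [Field F] [Field Ω] [Algebra F Ω] {E : IntermediateField F Ω}

theorem baseUnit_injective : Function.Injective (baseUnit E) :=
  Units.map_injective (algebraMap F E).injective

/-- The automorphism `g` multiplies `y` by `f ∈ Fˣ`. -/
def IsPair (g : E ≃ₐ[F] E) (y : Eˣ) (f : Fˣ) : Prop := unitsAct g y = baseUnit E f * y

theorem isPair_one_iff {g : E ≃ₐ[F] E} {y : Eˣ} : IsPair g y 1 ↔ unitsAct g y = y := by
  rw [IsPair, map_one, one_mul]

theorem isPair_one_left (y : Eˣ) : IsPair (1 : E ≃ₐ[F] E) y 1 := isPair_one_iff.2 rfl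

theorem IsPair.unique {g : E ≃ₐ[F] E} {y : Eˣ} {f f' : Fˣ} (h : IsPair g y f)
    (h' : IsPair g y f') : f = f' :=
  baseUnit_injective (mul_right_cancel (h.symm.trans h'))

theorem IsPair.mul {g g' : E ≃ₐ[F] E} {y : Eˣ} {f f' : Fˣ} (h : IsPair g y f)
    (h' : IsPair g' y f') : IsPair (g * g') y (f * f') := by
  rw [IsPair] at *
  rw [unitsAct_mul, h', map_mul, unitsAct_baseUnit, h, map_mul, ← mul_assoc,
    mul_comm (baseUnit E f')]

theorem IsPair.pow {g : E ≃ₐ[F] E} {y : Eˣ} {f : Fˣ} (h : IsPair g y f) (n : ℕ) :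
    IsPair (g ^ n) y (f ^ n) := by
  induction n with
  | zero => simpa using isPair_one_left y
  | succ n ih => rw [pow_succ, pow_succ]; exact ih.mul h

theorem IsPair.inv {g : E ≃ₐ[F] E} {y : Eˣ} {f : Fˣ} (h : IsPair g y f) :
    IsPair g⁻¹ y f⁻¹ := by
  have h2 : unitsAct g⁻¹ (unitsAct g y) = y := by
    rw [← unitsAct_mul, inv_mul_cancel, unitsAct_one]
  rw [IsPair] at *
  rw [h, map_mul, unitsAct_baseUnit] at h2
  rw [map_inv, eq_inv_mul_iff_mul_eq, h2]

theorem IsPair.mul_right {g : E ≃ₐ[F] E} {y y' : Eˣ} {f f' : Fˣ} (h : IsPair g y f)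
    (h' : IsPair g y' f') : IsPair g (y * y') (f * f') := by
  rw [IsPair] at *
  rw [map_mul, h, h', map_mul, mul_mul_mul_comm]

theorem IsPair.inv_right {g : E ≃ₐ[F] E} {y : Eˣ} {f : Fˣ} (h : IsPair g y f) :
    IsPair g y⁻¹ f⁻¹ := by
  rw [IsPair] at *
  rw [map_inv, h, mul_inv, map_inv]

theorem IsPair.div_right {g : E ≃ₐ[F] E} {y y' : Eˣ} {f f' : Fˣ} (h : IsPair g y f)
    (h' : IsPair g y' f') : IsPair g (y / y') (f / f') := by
  rw [div_eq_mul_inv, div_eq_mul_inv]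
  exact h.mul_right h'.inv_right

theorem exists_pow_eq_of_pow_eq_one {p : ℕ} (hp : p.Prime) {z κ : Fˣ} (hz : z ^ p = 1)
    (hz1 : z ≠ 1) (hκ : κ ^ p = 1) : ∃ e : ℕ, z ^ e = κ := by
  have := Fact.mk hp
  have hprim : IsPrimitiveRoot (z : F) p := by
    rw [IsPrimitiveRoot.coe_units_iff, ← orderOf_eq_prime hz hz1]
    exact IsPrimitiveRoot.orderOf z
  have := NeZero.of_pos hp.pos
  obtain ⟨e, -, he⟩ := hprim.eq_pow_of_pow_eq_one (ξ := (κ : F))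
    (by rw [← Units.val_pow_eq_pow_val, hκ, Units.val_one])
  exact ⟨e, by exact_mod_cast he⟩

theorem eq_zero_of_pow_val_eq_one {p : ℕ} (hp : p.Prime) {z : Fˣ} (hz : z ^ p = 1)
    (hz1 : z ≠ 1) {c : ZMod p} (hc : z ^ c.val = 1) : c = 0 := by
  have := Fact.mk hp
  have h := orderOf_dvd_of_pow_eq_one hc
  rw [orderOf_eq_prime hz hz1] at h
  exact (ZMod.val_eq_zero c).1 (Nat.eq_zero_of_dvd_of_lt h c.val_lt)

variable {p : ℕ} {K : IntermediateField F Ω} {σ : K ≃ₐ[F] K}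

theorem isPair_inclUnit (h : K ≤ E) {g : E ≃ₐ[F] E} (hg : IsRestriction g (1 : K ≃ₐ[F] K))
    (u : Kˣ) : IsPair g (inclUnit h u) 1 :=
  isPair_one_iff.2 (hg.unitsAct_inclUnit h u)

/-- The Kummer character of a `p`th root of an element of `K`. -/
theorem exists_isPair (hp : 0 < p) (hξ : ∃ ξ : F, IsPrimitiveRoot ξ p) (h : K ≤ E)
    {g : E ≃ₐ[F] E} (hg : IsRestriction g (1 : K ≃ₐ[F] K)) {y : Eˣ} {u : Kˣ}
    (hy : y ^ p = inclUnit h u) : ∃ f : Fˣ, f ^ p = 1 ∧ IsPair g y f :=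
  exists_eq_baseUnit_mul_of_pow_eq hp hξ
    (by rw [← map_pow, hy, hg.unitsAct_inclUnit h, unitsAct_one])

theorem exists_inclUnit_of_pow_eq (hp : 0 < p) (hξ : ∃ ξ : F, IsPrimitiveRoot ξ p) (h : K ≤ E)
    {y : Eˣ} {c : Kˣ} (hy : y ^ p = inclUnit h (c ^ p)) : ∃ v : Kˣ, y = inclUnit h v := by
  rw [map_pow] at hy
  obtain ⟨f, -, hf⟩ := exists_eq_baseUnit_mul_of_pow_eq hp hξ hy
  exact ⟨baseUnit K f * c, by rw [hf, map_mul, inclUnit_baseUnit]⟩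

/-- Since `s(w) = w^ρ w`, the automorphism `g` multiplies `s(w)` by `f' f`. As `s` fixes `F`, its
conjugate `s⁻¹ g s` multiplies `w` by the same factor, and `g⁻¹` removes `f`. -/
theorem IsPair.conj {g s : E ≃ₐ[F] E} {w : Eˣ} {f f' : Fˣ} (h : IsPair g w f)
    (h' : IsPair g (rhoPow s 1 w) f') : IsPair (s⁻¹ * g * s * g⁻¹) w f' := by
  have h1 : unitsAct s w = rhoPow s 1 w * w := unitsAct_rhoPow s 0 w
  have h2 : IsPair g (unitsAct s w) (f' * f) := h1 ▸ h'.mul_right h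
  have h3 : IsPair (s⁻¹ * g * s) w (f' * f) := by
    rw [IsPair] at h2 ⊢
    rw [unitsAct_mul, unitsAct_mul, h2, map_mul, unitsAct_baseUnit, ← unitsAct_mul,
      inv_mul_cancel, unitsAct_one]
  simpa using h3.mul h.inv

/-- The Kummer pairing turns the action of `τ⁻¹ - 1` on automorphisms into that of `s - 1` on
radicals. -/
theorem isPair_augGen_pow (hp : 0 < p) (hξ : ∃ ξ : F, IsPrimitiveRoot ξ p) (h : K ≤ E)
    {s : E ≃ₐ[F] E} (hs : IsRestriction s σ)
    {T : MonoidAlgebra (ZMod p) (K ≃ₐ[F] K) → (E ≃ₐ[F] E)}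
    (hT : ∀ a, IsRestriction (T a) (1 : K ≃ₐ[F] K))
    (hTσ : ∀ a, T (augGen p σ⁻¹ * a) = s⁻¹ * T a * s * (T a)⁻¹) {y : Eˣ} {u : Kˣ}
    (hy : y ^ p = inclUnit h u) (k : ℕ) {a : MonoidAlgebra (ZMod p) (K ≃ₐ[F] K)} {f : Fˣ}
    (hf : IsPair (T a) (rhoPow s k y) f) : IsPair (T (augGen p σ⁻¹ ^ k * a)) y f := by
  induction k generalizing y u with
  | zero => simpa [rhoPow_zero] using hf
  | succ k ih =>
    have hy1 : rhoPow s 1 y ^ p = inclUnit h (rhoPow σ 1 u) := by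
      rw [← rhoPow_pow, hy, hs.rhoPow_inclUnit h]
    rw [rhoPow_add] at hf
    have h2 := ih hy1 hf
    obtain ⟨f', -, hf'⟩ := exists_isPair hp hξ h (hT (augGen p σ⁻¹ ^ k * a)) hy
    rw [pow_succ', mul_assoc, hTσ]
    exact hf'.conj h2

/-- The fixed field of `g` contains `K` and a root of every `δ^{ρ^k}`, which generate `E`. Relations
in `Gal(E/K)` are thereby checked on the radicals `y^{ρ^k}`. -/
theorem eq_one_of_isPair_one (hp : 0 < p) (hξ : ∃ ξ : F, IsPrimitiveRoot ξ p)
    {δ : Kˣ} (h : K ≤ E) (hE : E = kummerField p σ δ) {s : E ≃ₐ[F] E} (hs : IsRestriction s σ)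
    {y : Eˣ} (hy : y ^ p = inclUnit h δ) {g : E ≃ₐ[F] E} (hg : IsRestriction g (1 : K ≃ₐ[F] K))
    (hgy : ∀ k, IsPair g (rhoPow s k y) 1) : g = 1 := by
  have hmem (x : E) (hx : g x = x) :
      (x : Ω) ∈ IntermediateField.lift (IntermediateField.fixedField (Subgroup.zpowers g)) := by
    rw [IntermediateField.mem_lift]
    rintro ⟨t, ht⟩
    exact Subgroup.zpowers_le.2 (show g ∈ MulAction.stabilizer (E ≃ₐ[F] E) x from hx) ht
  have h1 : E ≤ IntermediateField.lift (IntermediateField.fixedField (Subgroup.zpowers g)) := by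
    conv_lhs => rw [hE]
    refine kummerField_le hp hξ (fun x hx => hmem ⟨x, h hx⟩ (Subtype.ext (hg x (h hx) hx)))
      fun k => ?_
    refine ⟨(rhoPow s k y : E), hmem _ (congrArg Units.val (isPair_one_iff.1 (hgy k))), ?_⟩
    have h2 : rhoPow s k y ^ p = inclUnit h (rhoPow σ k δ) := by
      rw [← rhoPow_pow, hy, hs.rhoPow_inclUnit h]
    rw [← coe_inclUnit h, ← h2]
    simp
  refine AlgEquiv.ext fun x => ?_
  have h2 := (IntermediateField.mem_lift x).1 (h1 x.2)
  exact h2 ⟨g, Subgroup.mem_zpowers g⟩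

/-- The radical `y^{ρ^i}` agrees with `c` up to a root of unity of `F`, so it and all its further
`ρ`-powers lie in `K`. -/
theorem isPair_rhoPow_of_le (hp : 0 < p) (hξ : ∃ ξ : F, IsPrimitiveRoot ξ p)
    {δ : Kˣ} (h : K ≤ E) {s : E ≃ₐ[F] E} (hs : IsRestriction s σ) {i : ℕ} {c : Kˣ}
    (hc : rhoPow σ i δ = c ^ p) {y : Eˣ} (hy : y ^ p = inclUnit h δ) {g : E ≃ₐ[F] E}
    (hg : IsRestriction g (1 : K ≃ₐ[F] K)) {k : ℕ} (hk : i ≤ k) : IsPair g (rhoPow s k y) 1 := by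
  obtain ⟨m, rfl⟩ := Nat.exists_eq_add_of_le' hk
  obtain ⟨v, hv⟩ := exists_inclUnit_of_pow_eq hp hξ h (y := rhoPow s i y) (c := c)
    (by rw [← rhoPow_pow, hy, hs.rhoPow_inclUnit h, hc])
  rw [rhoPow_add, hv, hs.rhoPow_inclUnit h]
  exact isPair_inclUnit h hg _

end Characters

/-! ### `Gal(E/K)` as a cyclic module -/

section GaloisGroup

variable {p : ℕ} {F Ω : Type*} [Field F] [Field Ω] [Algebra F Ω] {K E : IntermediateField F Ω}
  {σ : K ≃ₐ[F] K}

/-- `Gal(E/K)` for `E = kummerField p σ δ` is generated, as a module, by an automorphism that moves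
a `p`th root of `δ^{ρ^{i-1}}`. -/
theorem exists_eq_of_isRestriction_one (hC : IsCyclicKummer p σ) {δ : Kˣ} (h : K ≤ E)
    (hE : E = kummerField p σ δ) {i : ℕ} {c : Kˣ} (hc : rhoPow σ i δ = c ^ p)
    {s : E ≃ₐ[F] E} (hs : IsRestriction s σ) {y : Eˣ} (hy : y ^ p = inclUnit h δ)
    {T : Multiplicative (MonoidAlgebra (ZMod p) (K ≃ₐ[F] K)) →* (E ≃ₐ[F] E)}
    (hT : ∀ a, IsRestriction (T a) (1 : K ≃ₐ[F] K))
    (hTσ : ∀ a, T (.ofAdd (augGen p σ⁻¹ * a)) = s⁻¹ * T (.ofAdd a) * s * (T (.ofAdd a))⁻¹)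
    {z : Fˣ} (hz : IsPair (T (.ofAdd 1)) (rhoPow s (i - 1) y) z) (hz1 : z ≠ 1)
    {g : E ≃ₐ[F] E} (hg : IsRestriction g (1 : K ≃ₐ[F] K)) : ∃ a, T a = g := by
  have hp := hC.prime.pos
  have hξ := hC.exists_root
  have hyk (k : ℕ) : rhoPow s k y ^ p = inclUnit h (rhoPow σ k δ) := by
    rw [← rhoPow_pow, hy, hs.rhoPow_inclUnit h]
  have hzp : z ^ p = 1 := by
    obtain ⟨f, hf, h'⟩ := exists_isPair hp hξ h (hT (.ofAdd 1)) (hyk (i - 1))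
    rw [hz.unique h', hf]
  -- Filter `Gal(E/K)` by the radicals that are moved: `n` may act nontrivially on `y^{ρ^k}` only
  -- for `k < m`.
  have key (m : ℕ) (hm : m ≤ i) (n : E ≃ₐ[F] E) (hn : IsRestriction n (1 : K ≃ₐ[F] K))
      (hnk : ∀ k, m ≤ k → IsPair n (rhoPow s k y) 1) : ∃ a, T a = n := by
    induction m generalizing n with
    | zero =>
      refine ⟨1, ?_⟩
      rw [map_one, eq_one_of_isPair_one hp hξ h hE hs hy hn fun k => hnk k k.zero_le]
    | succ m ih =>
      obtain ⟨κ, hκ, hκn⟩ := exists_isPair hp hξ h hn (hyk m)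
      obtain ⟨e, rfl⟩ := exists_pow_eq_of_pow_eq_one hC.prime hzp hz1 hκ
      -- By adjointness `T b` acts on `y^{ρ^m}` as `T 1` acts on `y^{ρ^{i-1}}`, that is by `z`, and
      -- it fixes all later radicals. So `n (T b)^{-e}` fixes `y^{ρ^m}` as well.
      set b : MonoidAlgebra (ZMod p) (K ≃ₐ[F] K) := augGen p σ⁻¹ ^ (i - 1 - m) * 1
      have hb (k : ℕ) {f : Fˣ} (hf : IsPair (T (.ofAdd 1)) (rhoPow s (i - 1 - m + k) y) f) :
          IsPair (T (.ofAdd b)) (rhoPow s k y) f := by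
        rw [rhoPow_add] at hf
        exact isPair_augGen_pow hp hξ h hs (T := fun a => T (.ofAdd a)) (fun a => hT _) hTσ
          (hyk k) _ hf
      have hbm : IsPair (T (.ofAdd b)) (rhoPow s m y) z := hb m (by
        rwa [show i - 1 - m + m = i - 1 by omega])
      have hbk (k : ℕ) (hk : m < k) : IsPair (T (.ofAdd b)) (rhoPow s k y) 1 :=
        hb k (isPair_rhoPow_of_le hp hξ h hs hc hy (hT _) (by omega))
      obtain ⟨a, ha⟩ := ih (by omega) (n * (T (.ofAdd b) ^ e)⁻¹)
        (by
          have h1 := hn.mul h (hT ((.ofAdd b ^ e)⁻¹))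
          rwa [map_inv, map_pow, one_mul] at h1)
        (fun k hk => by
          rcases hk.eq_or_lt with rfl | hk
          · simpa using hκn.mul (hbm.pow e).inv
          · simpa using (hnk k hk).mul ((hbk k hk).pow e).inv)
      exact ⟨a * .ofAdd b ^ e, by rw [map_mul, map_pow, ha, inv_mul_cancel_right]⟩
  exact key i le_rfl g hg fun k hk => isPair_rhoPow_of_le hp hξ h hs hc hy hg hk

/-- The kernel of the orbit map is `A_i`. -/
theorem orbit_map_eq_one_iff (hC : IsCyclicKummer p σ) {δ : Kˣ} (h : K ≤ E)
    (hE : E = kummerField p σ δ) {i : ℕ} {c : Kˣ} (hc : rhoPow σ i δ = c ^ p)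
    {s : E ≃ₐ[F] E} (hs : IsRestriction s σ) {y : Eˣ} (hy : y ^ p = inclUnit h δ)
    {T : Multiplicative (MonoidAlgebra (ZMod p) (K ≃ₐ[F] K)) →* (E ≃ₐ[F] E)}
    (hT : ∀ a, IsRestriction (T a) (1 : K ≃ₐ[F] K))
    (hTσ : ∀ a, T (.ofAdd (augGen p σ⁻¹ * a)) = s⁻¹ * T (.ofAdd a) * s * (T (.ofAdd a))⁻¹)
    {z : Fˣ} (hz : IsPair (T (.ofAdd 1)) (rhoPow s (i - 1) y) z) (hz1 : z ≠ 1)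
    (a : MonoidAlgebra (ZMod p) (K ≃ₐ[F] K)) : T (.ofAdd a) = 1 ↔ a ∈ subA p σ i := by
  have hp := hC.prime.pos
  have hξ := hC.exists_root
  have := Fact.mk hC.prime
  have hyk (k : ℕ) : rhoPow s k y ^ p = inclUnit h (rhoPow σ k δ) := by
    rw [← rhoPow_pow, hy, hs.rhoPow_inclUnit h]
  have hzp : z ^ p = 1 := by
    obtain ⟨f, hf, h'⟩ := exists_isPair hp hξ h (hT (.ofAdd 1)) (hyk (i - 1))
    rw [hz.unique h', hf]
  have hgen : ∀ g : K ≃ₐ[F] K, g ∈ Subgroup.zpowers σ⁻¹ := fun g => by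
    rw [Subgroup.zpowers_inv]
    exact hC.generates g
  have hθ (k m : ℕ) (b : MonoidAlgebra (ZMod p) (K ≃ₐ[F] K)) {f : Fˣ}
      (hf : IsPair (T (.ofAdd b)) (rhoPow s (k + m) y) f) :
      IsPair (T (.ofAdd (augGen p σ⁻¹ ^ k * b))) (rhoPow s m y) f := by
    rw [rhoPow_add] at hf
    exact isPair_augGen_pow hp hξ h hs (T := fun a => T (.ofAdd a)) (fun a => hT _) hTσ
      (hyk m) _ hf
  have hker {b : MonoidAlgebra (ZMod p) (K ≃ₐ[F] K)} (hb : b ∈ subA p σ⁻¹ i) :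
      T (.ofAdd b) = 1 := by
    obtain ⟨b, rfl⟩ := mem_subA_iff.1 hb
    rw [← ((commute_augGen hgen b).pow_left i).eq]
    exact eq_one_of_isPair_one hp hξ h hE hs hy (hT _) fun m => hθ i m b
      (isPair_rhoPow_of_le hp hξ h hs hc hy (hT _) (by omega))
  rw [← subA_inv hC.generates]
  refine ⟨fun ha => ?_, hker⟩
  by_contra hmem
  -- A multiple of `a` is `c' (τ⁻¹ - 1)^{i-1}` modulo the kernel with `c' ≠ 0`, but this acts on `y`
  -- by `z^{c'}`, which would have to be `1`.
  obtain ⟨k, c', hc', hk⟩ := exists_pow_mul_sub_mem hgen hmem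
  refine hc' (eq_zero_of_pow_val_eq_one hC.prime hzp hz1 ?_)
  have h1 : IsPair (T (.ofAdd (augGen p σ⁻¹ ^ k * a))) y 1 :=
    hθ k 0 a (by rw [ha]; exact isPair_one_left _)
  have h2 : T (.ofAdd (augGen p σ⁻¹ ^ k * a)) =
      T (.ofAdd (augGen p σ⁻¹ ^ (i - 1) * 1)) ^ c'.val := by
    have h3 := hker hk
    rw [ofAdd_sub, map_div, div_eq_one] at h3
    rw [h3, ← map_pow, ← ofAdd_nsmul, mul_one, ← Nat.cast_smul_eq_nsmul (ZMod p),
      ZMod.natCast_zmod_val]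
  rw [h2] at h1
  exact ((hθ (i - 1) 0 1 (by simpa using hz)).pow c'.val).unique h1

end GaloisGroup

/-! ### Homomorphisms out of `B_{i,0}` -/

section ModuleAction

/-- An abelian normal subgroup of exponent `p` is a module over `𝔽_p[G]` for every `G` that acts on
it by conjugation; this is the orbit map of an element. -/
theorem exists_conj_orbit_map (p : ℕ) {G Γ : Type*} [Group G] [Group Γ] (N : Subgroup Γ) [N.Normal]
    (hcomm : ∀ a ∈ N, ∀ b ∈ N, a * b = b * a) (hN : ∀ a ∈ N, a ^ p = 1) (f : G →* Γ)
    {ν : Γ} (hν : ν ∈ N) :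
    ∃ T : Multiplicative (MonoidAlgebra (ZMod p) G) →* Γ, T (.ofAdd 1) = ν ∧ (∀ a, T a ∈ N) ∧
      ∀ g a, T (.ofAdd (MonoidAlgebra.of (ZMod p) G g * a)) = f g * T (.ofAdd a) * (f g)⁻¹ := by
  let _ : CommGroup N :=
    { (inferInstance : Group N) with
      mul_comm := fun a b => Subtype.ext (hcomm a a.2 b b.2) }
  let c : G →* AddMonoid.End (Additive N) :=
    { toFun := fun g => MonoidHom.toAdditive (MulAut.conjNormal (f g)).toMonoidHom
      map_one' := by rw [map_one, map_one]; rfl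
      map_mul' := fun g h => by rw [map_mul, map_mul]; rfl }
  obtain ⟨T, hT1, hT⟩ := exists_orbit_map p (V := Additive N)
    (fun x => Additive.toMul.injective (Subtype.ext (hN _ x.toMul.2))) c (.ofMul ⟨ν, hν⟩)
  refine ⟨N.subtype.comp (AddMonoidHom.toMultiplicativeLeft T), ?_, fun a => Subtype.property _,
    fun g a => ?_⟩
  · exact congrArg (fun x : Additive N => (x.toMul : Γ)) hT1
  · exact congrArg (fun x : Additive N => (x.toMul : Γ)) (hT g a)

/-- A homomorphism on `B_{i,0}` from compatible homomorphisms on `A` and on `G`. -/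
theorem exists_hom_groupB (p : ℕ) {G Γ : Type*} [Group G] [Group Γ] (σ : G) (i : ℕ) (f : G →* Γ)
    (T : Multiplicative (MonoidAlgebra (ZMod p) G) →* Γ)
    (hT : ∀ a ∈ subA p σ i, T (.ofAdd a) = 1)
    (hTf : ∀ g a, T (.ofAdd (MonoidAlgebra.of (ZMod p) G g * a)) = f g * T (.ofAdd a) * (f g)⁻¹) :
    ∃ Θ : groupB p σ i →* Γ, (∀ g, Θ (SemidirectProduct.inr g) = f g) ∧
      ∀ a, Θ (SemidirectProduct.inl (.ofAdd (Submodule.Quotient.mk a))) = T (.ofAdd a) := by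
  have hout (a : MonoidAlgebra (ZMod p) G) :
      T (.ofAdd (Quotient.out (Submodule.Quotient.mk a : quotA p σ i))) = T (.ofAdd a) := by
    rw [← div_eq_one, ← map_div, ← ofAdd_sub]
    exact hT _ ((Submodule.Quotient.eq _).1 (Quotient.out_eq _))
  let t : Multiplicative (quotA p σ i) →* Γ := MonoidHom.mk' (fun x => T (.ofAdd x.toAdd.out))
    (by
      intro x y
      induction x using Multiplicative.rec with | _ x => ?_
      induction y using Multiplicative.rec with | _ y => ?_
      obtain ⟨a, rfl⟩ := Submodule.Quotient.mk_surjective _ x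
      obtain ⟨b, rfl⟩ := Submodule.Quotient.mk_surjective _ y
      rw [← ofAdd_add, ← Submodule.Quotient.mk_add]
      simp only [toAdd_ofAdd, hout, ofAdd_add, map_mul])
  have ht (a : MonoidAlgebra (ZMod p) G) :
      t (.ofAdd (Submodule.Quotient.mk a : quotA p σ i)) = T (.ofAdd a) := hout a
  refine ⟨SemidirectProduct.lift t f fun g => ?_, fun g => SemidirectProduct.lift_inr _ _ _ g,
    fun a => ?_⟩
  · refine MonoidHom.ext fun x => ?_
    induction x using Multiplicative.rec with | _ x => ?_
    obtain ⟨a, rfl⟩ := Submodule.Quotient.mk_surjective _ x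
    exact (ht (MonoidAlgebra.of (ZMod p) G g * a)).trans ((hTf g a).trans (by rw [← ht a]; rfl))
  · rw [SemidirectProduct.lift_inl, ht]

theorem inl_mul_eq_conj (p : ℕ) {G : Type*} [Group G] (σ : G) (i : ℕ) (g : G)
    (a : MonoidAlgebra (ZMod p) G) :
    (SemidirectProduct.inl (.ofAdd (Submodule.Quotient.mk (MonoidAlgebra.of (ZMod p) G g * a))) :
      groupB p σ i) = SemidirectProduct.inr g *
        SemidirectProduct.inl (.ofAdd (Submodule.Quotient.mk a)) *
          (SemidirectProduct.inr g)⁻¹ := by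
  have h := SemidirectProduct.inl_aut (φ := actA p σ i) g (.ofAdd (Submodule.Quotient.mk a))
  rw [map_inv] at h
  exact h

/-- Homomorphisms on `B_{i,0}` are determined by their values on the two generators. -/
theorem groupB_hom_ext {p : ℕ} [Fact p.Prime] {G Γ : Type*} [Group G] [Group Γ] {σ : G}
    (hσ : ∀ g : G, g ∈ Subgroup.zpowers σ) {i : ℕ} {f₁ f₂ : groupB p σ i →* Γ}
    (h : f₁ (SemidirectProduct.inr σ) = f₂ (SemidirectProduct.inr σ))
    (h' : f₁ (SemidirectProduct.inl (.ofAdd (Submodule.Quotient.mk 1))) =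
      f₂ (SemidirectProduct.inl (.ofAdd (Submodule.Quotient.mk 1)))) : f₁ = f₂ := by
  have hr (g : G) : f₁ (SemidirectProduct.inr g) = f₂ (SemidirectProduct.inr g) := by
    obtain ⟨k, rfl⟩ := hσ g
    simp only [map_zpow, h]
  refine SemidirectProduct.hom_ext (MonoidHom.ext fun x => ?_) (MonoidHom.ext hr)
  induction x using Multiplicative.rec with | _ x => ?_
  obtain ⟨a, rfl⟩ := Submodule.Quotient.mk_surjective _ x
  simp only [MonoidHom.comp_apply]
  induction a using MonoidAlgebra.induction_on with
  | of g =>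
    rw [← mul_one (MonoidAlgebra.of (ZMod p) G g), inl_mul_eq_conj]
    simp only [map_mul, map_inv, hr, h']
  | add a b ha hb =>
    rw [Submodule.Quotient.mk_add, ofAdd_add]
    simp only [map_mul, ha, hb]
  | smul r a ha =>
    have e : r • a = r.val • a := by
      rw [← Nat.cast_smul_eq_nsmul (ZMod p), ZMod.natCast_zmod_val]
    rw [e, Submodule.Quotient.mk_smul, ofAdd_nsmul]
    simp only [map_pow, ha]

end ModuleAction

/-! ### Identifications of Galois groups with `B_{j,0}` -/

section GaloisGroup

variable {p : ℕ} {F Ω : Type*} [Field F] [Field Ω] [Algebra F Ω] {K E : IntermediateField F Ω}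
  {σ : K ≃ₐ[F] K}

/-- The orbit map attached to an identification of `Gal(E/F)` with `B_{j,0}`. -/
theorem identification_symm_augGen_mul {j : ℕ} (φ : (E ≃ₐ[F] E) ≃* groupB p σ j)
    (a : MonoidAlgebra (ZMod p) (K ≃ₐ[F] K)) :
    φ.symm (SemidirectProduct.inl (.ofAdd (Submodule.Quotient.mk (augGen p σ⁻¹ * a)))) =
      (φ.symm (SemidirectProduct.inr σ))⁻¹ *
        φ.symm (SemidirectProduct.inl (.ofAdd (Submodule.Quotient.mk a))) *
        φ.symm (SemidirectProduct.inr σ) *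
        (φ.symm (SemidirectProduct.inl (.ofAdd (Submodule.Quotient.mk a))))⁻¹ := by
  rw [augGen, sub_mul, one_mul, Submodule.Quotient.mk_sub, ofAdd_sub, map_div, map_div,
    inl_mul_eq_conj, map_mul, map_mul]
  simp only [map_inv, inv_inv, div_eq_mul_inv]

theorem IsIdentification.exists_eq {j : ℕ} {φ : (E ≃ₐ[F] E) ≃* groupB p σ j}
    (hφ : IsIdentification p σ E φ) {g : E ≃ₐ[F] E} (hg : IsRestriction g (1 : K ≃ₐ[F] K)) :
    ∃ a, φ.symm (SemidirectProduct.inl (.ofAdd (Submodule.Quotient.mk a))) = g := by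
  obtain ⟨a, ha⟩ := Submodule.Quotient.mk_surjective _ (φ g).left.toAdd
  refine ⟨a, ?_⟩
  have h1 := SemidirectProduct.inl_left_mul_inr_right (φ g)
  rw [hφ g 1 hg, map_one, mul_one] at h1
  rw [MulEquiv.symm_apply_eq, ← h1, ha]
  rfl

variable [IsGalois F K]

/-- The identification of `Gal(E/F)` with `B_{i,0}` for `E = kummerField p σ δ`, given a lift `s` of
`σ` of order `p` and a generator `ν` of `Gal(E/K)`. -/
theorem exists_identification (hC : IsCyclicKummer p σ) {δ : Kˣ} (h : K ≤ E)
    (hE : E = kummerField p σ δ) {i : ℕ} {c : Kˣ} (hc : rhoPow σ i δ = c ^ p)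
    {s : E ≃ₐ[F] E} (hs : IsRestriction s σ) (hsp : s ^ p = 1) {y : Eˣ}
    (hy : y ^ p = inclUnit h δ) {ν : E ≃ₐ[F] E} (hν : IsRestriction ν (1 : K ≃ₐ[F] K))
    (hνy : unitsAct ν (rhoPow s (i - 1) y) ≠ rhoPow s (i - 1) y) :
    ∃ ψ : (E ≃ₐ[F] E) ≃* groupB p σ i, IsIdentification p σ E ψ ∧
      ψ s = SemidirectProduct.inr σ ∧
        ψ ν = SemidirectProduct.inl (.ofAdd (Submodule.Quotient.mk 1)) := by
  have hp := hC.prime.pos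
  have hξ := hC.exists_root
  have hord := orderOf_generator hp hC.finrank_eq hC.generates
  have hyk (k : ℕ) : rhoPow s k y ^ p = inclUnit h (rhoPow σ k δ) := by
    rw [← rhoPow_pow, hy, hs.rhoPow_inclUnit h]
  have hmem {g : E ≃ₐ[F] E} : g ∈ (resHom h).ker ↔ IsRestriction g (1 : K ≃ₐ[F] K) :=
    resHom_eq_iff h
  have hpair {g : E ≃ₐ[F] E} (hg : g ∈ (resHom h).ker) (k : ℕ) :=
    exists_isPair hp hξ h (hmem.1 hg) (hyk k)
  -- Elements of the kernel act on each radical through characters with values in the commutative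
  -- group `Fˣ`, so commutators act trivially.
  have hcomm : ∀ a ∈ (resHom h).ker, ∀ b ∈ (resHom h).ker, a * b = b * a := by
    intro a ha b hb
    rw [← mul_inv_eq_one]
    have hab := mul_mem (mul_mem ha hb) (inv_mem (mul_mem hb ha))
    refine eq_one_of_isPair_one hp hξ h hE hs hy (hmem.1 hab) fun k => ?_
    obtain ⟨f, -, hf⟩ := hpair ha k
    obtain ⟨f', -, hf'⟩ := hpair hb k
    have h1 := (hf.mul hf').mul (hf'.mul hf).inv
    rwa [mul_comm f' f, mul_inv_cancel] at h1
  have hexp : ∀ a ∈ (resHom h).ker, a ^ p = 1 := by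
    intro a ha
    refine eq_one_of_isPair_one hp hξ h hE hs hy (hmem.1 (pow_mem ha p)) fun k => ?_
    obtain ⟨f, hf, hf'⟩ := hpair ha k
    exact hf ▸ hf'.pow p
  -- Here `s^p = 1` is used: `σ ↦ s` extends to a section of the restriction map to `G`.
  let f₂ : (K ≃ₐ[F] K) →* (E ≃ₐ[F] E) := monoidHomOfForallMemZpowers hC.generates (g' := s)
    (hord.symm ▸ orderOf_dvd_of_pow_eq_one hsp)
  have hf₂ : f₂ σ = s := monoidHomOfForallMemZpowers_apply_gen _ _
  have hres (g : K ≃ₐ[F] K) : resHom h (f₂ g) = g := by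
    obtain ⟨k, rfl⟩ := hC.generates g
    rw [map_zpow, map_zpow, hf₂, (resHom_eq_iff h).2 hs]
  obtain ⟨T, hT1, hTN, hTf⟩ := exists_conj_orbit_map p _ hcomm hexp f₂ (hmem.2 hν)
  have hTN' (a) : IsRestriction (T a) (1 : K ≃ₐ[F] K) := hmem.1 (hTN a)
  have hTσ (a) : T (.ofAdd (augGen p σ⁻¹ * a)) = s⁻¹ * T (.ofAdd a) * s * (T (.ofAdd a))⁻¹ := by
    rw [augGen, sub_mul, one_mul, ofAdd_sub, map_div, hTf, map_inv, hf₂, inv_inv, div_eq_mul_inv]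
  obtain ⟨z, -, hz⟩ := hpair (hmem.2 hν) (i - 1)
  have hz1 : z ≠ 1 := by
    rintro rfl
    exact hνy (isPair_one_iff.1 hz)
  rw [← hT1] at hz
  have hker := orbit_map_eq_one_iff hC h hE hc hs hy hTN' hTσ hz hz1
  obtain ⟨Θ, hΘr, hΘl⟩ := exists_hom_groupB p σ i f₂ T (fun a ha => (hker a).2 ha) hTf
  have hΘres (b : groupB p σ i) : resHom h (Θ b) = b.right := by
    have hb := SemidirectProduct.inl_left_mul_inr_right b
    obtain ⟨a, ha⟩ := Submodule.Quotient.mk_surjective _ b.left.toAdd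
    have hl : Θ (SemidirectProduct.inl b.left) = T (.ofAdd a) := by
      rw [← hΘl, ha]; rfl
    rw [← hb, map_mul, map_mul, hl, hΘr, hres, MonoidHom.mem_ker.1 (hTN _), one_mul]
    simp
  have hbij : Function.Bijective Θ := by
    refine ⟨(injective_iff_map_eq_one Θ).2 fun b hb => ?_, fun g => ?_⟩
    · have hr : b.right = 1 := by rw [← hΘres, hb, map_one]
      obtain ⟨a, ha⟩ := Submodule.Quotient.mk_surjective _ b.left.toAdd
      have hb' : b = SemidirectProduct.inl (.ofAdd (Submodule.Quotient.mk a)) := by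
        rw [← SemidirectProduct.inl_left_mul_inr_right b, hr, map_one, mul_one, ha]; rfl
      rw [hb', hΘl, hker, ← Submodule.Quotient.mk_eq_zero] at hb
      rw [hb', hb, ofAdd_zero, map_one]
    · have hg : IsRestriction (g * (f₂ (resHom h g))⁻¹) (1 : K ≃ₐ[F] K) := by
        rw [← hmem, MonoidHom.mem_ker, map_mul, map_inv, hres, mul_inv_cancel]
      obtain ⟨a, ha⟩ := exists_eq_of_isRestriction_one hC h hE hc hs hy hTN' hTσ hz hz1 hg
      refine ⟨SemidirectProduct.inl (.ofAdd (Submodule.Quotient.mk a.toAdd)) *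
        SemidirectProduct.inr (resHom h g), ?_⟩
      rw [map_mul, hΘl, hΘr, ofAdd_toAdd, ha, inv_mul_cancel_right]
  refine ⟨(MulEquiv.ofBijective Θ hbij).symm, fun g g' hg => ?_, ?_, ?_⟩
  · rw [← hΘres, ← (resHom_eq_iff h).2 hg]
    exact congrArg _ ((MulEquiv.ofBijective Θ hbij).apply_symm_apply g)
  · rw [MulEquiv.symm_apply_eq, MulEquiv.ofBijective_apply, hΘr, hf₂]
  · rw [MulEquiv.symm_apply_eq, MulEquiv.ofBijective_apply, hΘl, hT1]

theorem IsIdentification.isRestriction_symm (h : K ≤ E) {j : ℕ}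
    {φ : (E ≃ₐ[F] E) ≃* groupB p σ j} (hφ : IsIdentification p σ E φ) (b : groupB p σ j) :
    IsRestriction (φ.symm b) b.right := by
  have h1 := hφ (φ.symm b) _ (isRestriction_resHom h _)
  rw [MulEquiv.apply_symm_apply] at h1
  rw [h1]
  exact isRestriction_resHom h _

/-- If `Gal(E/F) ≅ B_{j,0}` for `E = kummerField p σ γ`, then `γ^{ρ^j}` is a `p`th power. -/
theorem IsIdentification.exists_rhoPow_eq_pow (hC : IsCyclicKummer p σ) {γ : Kˣ} (h : K ≤ E)
    [IsGalois F E] {j : ℕ} {φ : (E ≃ₐ[F] E) ≃* groupB p σ j}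
    (hφ : IsIdentification p σ E φ) {y : Eˣ} (hy : y ^ p = inclUnit h γ) :
    ∃ c : Kˣ, rhoPow σ j γ = c ^ p := by
  have hp := hC.prime.pos
  have hξ := hC.exists_root
  have := Fact.mk hC.prime
  have hs := hφ.isRestriction_symm h (SemidirectProduct.inr σ)
  rw [SemidirectProduct.right_inr] at hs
  set s := φ.symm (SemidirectProduct.inr σ) with hsdef
  have hyk (k : ℕ) : rhoPow s k y ^ p = inclUnit h (rhoPow σ k γ) := by
    rw [← rhoPow_pow, hy, hs.rhoPow_inclUnit h]
  have hT (a : MonoidAlgebra (ZMod p) (K ≃ₐ[F] K)) :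
      IsRestriction (φ.symm (SemidirectProduct.inl (.ofAdd (Submodule.Quotient.mk a))))
        (1 : K ≃ₐ[F] K) := hφ.isRestriction_symm h _
  have hfix : ((rhoPow s j y : E) : Ω) ∈ K := by
    refine mem_of_fixed h fun g hg => ?_
    obtain ⟨a, rfl⟩ := hφ.exists_eq hg
    obtain ⟨f, -, hf⟩ := exists_isPair hp hξ h hg (hyk j)
    have h1 := isPair_augGen_pow hp hξ h hs hT (identification_symm_augGen_mul φ) hy j hf
    -- `(τ⁻¹ - 1)^j` annihilates `A/A_j`, so by adjointness `Gal(E/K)` fixes `y^{ρ^j}`.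
    have h2 : augGen p σ⁻¹ ^ j * a ∈ subA p σ j := by
      have hgen : ∀ g : K ≃ₐ[F] K, g ∈ Subgroup.zpowers σ⁻¹ := fun g => by
        rw [Subgroup.zpowers_inv]
        exact hC.generates g
      rw [← subA_inv hC.generates, ((commute_augGen hgen a).pow_left j).eq]
      exact mul_augGen_pow_mem j a
    rw [(Submodule.Quotient.mk_eq_zero _).2 h2, ofAdd_zero, map_one, map_one] at h1
    rw [h1.unique (isPair_one_left y)] at hf
    exact congrArg Units.val (isPair_one_iff.1 hf)
  obtain ⟨v, hv⟩ := exists_inclUnit_eq h hfix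
  refine ⟨v, inclUnit_injective h ?_⟩
  rw [map_pow, hv, hyk]

/-- If `Gal(E/F) ≅ B_{j,0}` for `E = kummerField p σ γ`, then the generator of `Gal(E/K)` moves the
`p`th roots of `γ^{ρ^{j-1}}`. -/
theorem IsIdentification.generator_moves (hC : IsCyclicKummer p σ) {γ : Kˣ} (h : K ≤ E)
    (hE : E = kummerField p σ γ) [IsGalois F E] [IsAlgClosed Ω] {j : ℕ} (hj : 1 ≤ j) (hjp : j ≤ p)
    {φ : (E ≃ₐ[F] E) ≃* groupB p σ j} (hφ : IsIdentification p σ E φ) {b : Eˣ}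
    (hb : b ^ p = inclUnit h (rhoPow σ (j - 1) γ)) :
    unitsAct (φ.symm (SemidirectProduct.inl (.ofAdd (Submodule.Quotient.mk 1)))) b ≠ b := by
  have hp := hC.prime.pos
  have hξ := hC.exists_root
  have := Fact.mk hC.prime
  have hs := hφ.isRestriction_symm h (SemidirectProduct.inr σ)
  rw [SemidirectProduct.right_inr] at hs
  set s := φ.symm (SemidirectProduct.inr σ) with hsdef
  have hT (a : MonoidAlgebra (ZMod p) (K ≃ₐ[F] K)) :
      IsRestriction (φ.symm (SemidirectProduct.inl (.ofAdd (Submodule.Quotient.mk a))))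
        (1 : K ≃ₐ[F] K) := hφ.isRestriction_symm h _
  intro hfix
  have hroot : HasRoot p E γ := by
    rw [hE]
    exact hasRoot_kummerField hp γ 0
  obtain ⟨y, hy⟩ := hroot.exists_unit hp h
  have hyk (k : ℕ) : rhoPow s k y ^ p = inclUnit h (rhoPow σ k γ) := by
    rw [← rhoPow_pow, hy, hs.rhoPow_inclUnit h]
  obtain ⟨c, hc⟩ := hφ.exists_rhoPow_eq_pow hC h hy
  have hyj : IsPair (φ.symm (SemidirectProduct.inl (.ofAdd (Submodule.Quotient.mk 1))))
      (rhoPow s (j - 1) y) 1 := by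
    obtain ⟨f, -, hf⟩ := exists_eq_baseUnit_mul_of_pow_eq hp hξ ((hyk (j - 1)).trans hb.symm)
    rw [isPair_one_iff, hf, map_mul, hfix, unitsAct_baseUnit]
  -- If `b` were fixed, `(τ⁻¹ - 1)^{j-1}` would act trivially on every radical and so vanish in
  -- `A/A_j`, which it does not.
  have hone : φ.symm (SemidirectProduct.inl (.ofAdd
      (Submodule.Quotient.mk (augGen p σ⁻¹ ^ (j - 1) * 1)))) = 1 := by
    refine eq_one_of_isPair_one hp hξ h hE hs hy (hT _) fun m => ?_
    refine isPair_augGen_pow hp hξ h hs hT (identification_symm_augGen_mul φ) (hyk m) _ ?_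
    rw [← rhoPow_add]
    rcases Nat.eq_zero_or_pos m with rfl | hm
    · exact hyj
    · exact isPair_rhoPow_of_le hp hξ h hs hc hy (hT _) (by omega)
  rw [MulEquiv.symm_apply_eq, map_one, ← map_one SemidirectProduct.inl,
    SemidirectProduct.inl_inj, ← ofAdd_zero, Multiplicative.ofAdd.injective.eq_iff,
    Submodule.Quotient.mk_eq_zero, mul_one, ← subA_inv hC.generates] at hone
  refine augGen_pow_pred_notMem ?_ hj hjp hone
  rw [orderOf_inv, orderOf_generator hp hC.finrank_eq hC.generates]

end GaloisGroup

/-! ### The explicit fields are solutions -/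

section Solutions

variable {p : ℕ} {F Ω : Type*} [Field F] [Field Ω] [Algebra F Ω] {K L Lt : IntermediateField F Ω}
  {σ : K ≃ₐ[F] K}

theorem unitsAct_rhoPow_comm {E : IntermediateField F Ω} {s t : E ≃ₐ[F] E} (h : Commute t s)
    (k : ℕ) (y : Eˣ) : unitsAct t (rhoPow s k y) = rhoPow s k (unitsAct t y) := by
  induction k with
  | zero => rfl
  | succ k ih =>
    rw [rhoPow_succ, rhoPow_succ, map_div, ← unitsAct_mul, h.eq, unitsAct_mul, ih]

theorem rhoPow_sub_baseUnit_mul {i j : ℕ} (hij : j < i) (hi : i ≤ p) {γ ω c : Kˣ}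
    (hγ : rhoPow σ (p - j) ω = γ * c ^ p) (f : Fˣ) :
    rhoPow σ (i - j) (baseUnit K f * rhoPow σ (p - i) ω) = γ * c ^ p := by
  rw [rhoPow_baseUnit_mul σ (by omega), ← rhoPow_add, ← hγ]
  congr 1
  omega

variable [IsGalois F K]

/-- A lift `s` of `σ` has order `p` when it fixes the product of the `s`-conjugates of a `p`th root
of `δ`. -/
theorem pow_eq_one_of_unitsAct_orbitProd (hC : IsCyclicKummer p σ) {E : IntermediateField F Ω}
    {δ : Kˣ} (h : K ≤ E) (hE : E = kummerField p σ δ) {s : E ≃ₐ[F] E} (hs : IsRestriction s σ)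
    {y : Eˣ} (hy : y ^ p = inclUnit h δ)
    (hn : unitsAct s (orbitProd s p y) = orbitProd s p y) : s ^ p = 1 := by
  have hp := hC.prime.pos
  have hsp : IsRestriction (s ^ p) (1 : K ≃ₐ[F] K) := by
    rw [← resHom_eq_iff h, map_pow, (resHom_eq_iff h).2 hs,
      pow_eq_one_generator hp hC.finrank_eq hC.generates]
  have hfix : unitsAct (s ^ p) y = y := by
    rw [← div_eq_one, unitsAct_pow_div, hn, div_self']
  refine eq_one_of_isPair_one hp hC.exists_root h hE hs hy hsp fun k => ?_
  rw [isPair_one_iff, unitsAct_rhoPow_comm ((Commute.refl s).pow_left p), hfix]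

variable [IsAlgClosed Ω]

/-- A lift of the generator of `Gal(L/K)` moves the `p`th roots of `δ^{ρ^{i-1}}`. -/
theorem lift_generator_moves (hC : IsCyclicKummer p σ) {i j : ℕ} (hj : 1 ≤ j) (hij : j < i)
    (hi : i ≤ p) {γ δ c : Kˣ} (hδγ : rhoPow σ (i - j) δ = γ * c ^ p) (h : K ≤ L) (h' : L ≤ Lt)
    (hL : L = kummerField p σ γ) [IsGalois F L] {φ : (L ≃ₐ[F] L) ≃* groupB p σ j}
    (hφ : IsIdentification p σ L φ) {ν : Lt ≃ₐ[F] Lt}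
    (hν : φ (resHom h' ν) = SemidirectProduct.inl (.ofAdd (Submodule.Quotient.mk 1))) {b : Ltˣ}
    (hb : b ^ p = inclUnit (h.trans h') (rhoPow σ (i - 1) δ)) : unitsAct ν b ≠ b := by
  have hp := hC.prime.pos
  have hν' : resHom h' ν = φ.symm (SemidirectProduct.inl (.ofAdd (Submodule.Quotient.mk 1))) := by
    rw [MulEquiv.eq_symm_apply, hν]
  have hνL : IsRestriction ν (φ.symm (SemidirectProduct.inl (.ofAdd (Submodule.Quotient.mk 1)))) :=
    (resHom_eq_iff h').1 hν'
  have hνK : IsRestriction ν (1 : K ≃ₐ[F] K) := hνL.trans h h' (hφ.isRestriction_symm h _)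
  have hroot : HasRoot p L (rhoPow σ (j - 1) γ) := by
    rw [hL]
    exact hasRoot_kummerField hp γ _
  obtain ⟨b', hb'⟩ := hroot.exists_unit hp h
  intro hfix
  apply hφ.generator_moves hC h hL hj (by omega) hb'
  apply inclUnit_injective h'
  rw [← hνL.unitsAct_inclUnit h']
  -- `δ^{ρ^{i-1}}` is `γ^{ρ^{j-1}}` times a `p`th power from `K`, so the two roots differ by a
  -- factor in `K`, on which `ν` is trivial.
  have e : b ^ p = (inclUnit h' b' * inclUnit (h.trans h') (rhoPow σ (j - 1) c)) ^ p := by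
    have e1 : rhoPow σ (i - 1) δ = rhoPow σ (j - 1) γ * rhoPow σ (j - 1) c ^ p := by
      rw [← rhoPow_pow, ← rhoPow_mul, ← hδγ, ← rhoPow_add]
      congr 1
      omega
    rw [hb, e1, map_mul, mul_pow, ← map_pow (inclUnit h'), hb', map_pow]
    congr 1
  obtain ⟨f, -, hf⟩ := exists_eq_baseUnit_mul_of_pow_eq hp hC.exists_root e
  rw [hf, map_mul, map_mul, unitsAct_baseUnit, hνK.unitsAct_inclUnit, unitsAct_one] at hfix
  exact mul_right_cancel (mul_left_cancel hfix)

theorem exists_rhoPow_eq_pow_of_eq (hC : IsCyclicKummer p σ) {i j : ℕ} (hij : j < i)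
    {γ δ c : Kˣ} (hδγ : rhoPow σ (i - j) δ = γ * c ^ p) (h : K ≤ L)
    (hL : L = kummerField p σ γ) [IsGalois F L] {φ : (L ≃ₐ[F] L) ≃* groupB p σ j}
    (hφ : IsIdentification p σ L φ) : ∃ c' : Kˣ, rhoPow σ i δ = c' ^ p := by
  have hroot : HasRoot p L γ := by
    rw [hL]
    exact hasRoot_kummerField hC.prime.pos γ 0
  obtain ⟨b, hb⟩ := hroot.exists_unit hC.prime.pos h
  obtain ⟨d, hd⟩ := hφ.exists_rhoPow_eq_pow hC h hb
  refine ⟨d * rhoPow σ j c, ?_⟩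
  rw [mul_pow, ← hd, ← rhoPow_pow, ← rhoPow_mul, ← hδγ, ← rhoPow_add]
  congr 1
  omega

/-- A lift `ν` of the generator of `Gal(L/K)` still moves the last radical, so `s` and `ν` define
`ψ`. Compatibility with `φ` need only be checked on these two generators, where it holds by their
choice. -/
theorem isSolutionFor_of_lift (hC : IsCyclicKummer p σ) {i j : ℕ} (hj : 1 ≤ j) (hij : j < i)
    (hi : i ≤ p) {γ δ c : Kˣ} (hδγ : rhoPow σ (i - j) δ = γ * c ^ p) (h : K ≤ L) (h' : L ≤ Lt)
    (hL : L = kummerField p σ γ) (hLt : Lt = kummerField p σ δ) [IsGalois F L] [IsGalois F Lt]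
    {φ : (L ≃ₐ[F] L) ≃* groupB p σ j} (hφ : IsIdentification p σ L φ) {s : Lt ≃ₐ[F] Lt}
    (hsp : s ^ p = 1) (hs : φ (resHom h' s) = SemidirectProduct.inr σ) :
    IsSolutionFor p σ hij.le L φ Lt := by
  have hp := hC.prime.pos
  have := Fact.mk hC.prime
  obtain ⟨ν, hν⟩ := resHom_surjective h'
    (φ.symm (SemidirectProduct.inl (.ofAdd (Submodule.Quotient.mk 1))))
  have hνφ : φ (resHom h' ν) = SemidirectProduct.inl (.ofAdd (Submodule.Quotient.mk 1)) := by
    rw [hν, MulEquiv.apply_symm_apply]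
  have hνK : IsRestriction ν (1 : K ≃ₐ[F] K) :=
    ((resHom_eq_iff h').1 hν).trans h h' (hφ.isRestriction_symm h _)
  have hsK : IsRestriction s σ := by
    have h1 : resHom h' s = φ.symm (SemidirectProduct.inr σ) := by
      rw [MulEquiv.eq_symm_apply, hs]
    exact ((resHom_eq_iff h').1 h1).trans h h' (hφ.isRestriction_symm h _)
  have hroot : HasRoot p Lt δ := by
    rw [hLt]
    exact hasRoot_kummerField hp δ 0
  obtain ⟨y, hy⟩ := hroot.exists_unit hp (h.trans h')
  obtain ⟨c', hc'⟩ := exists_rhoPow_eq_pow_of_eq hC hij hδγ h hL hφ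
  obtain ⟨ψ, -, hψs, hψν⟩ := exists_identification hC (h.trans h') hLt hc' hsK hsp hy hνK
    (lift_generator_moves hC hj hij hi hδγ h h' hL hφ hνφ
      (by rw [← rhoPow_pow, hy, hsK.rhoPow_inclUnit]))
  refine ⟨h', inferInstance, ψ, fun g g' hg => ?_⟩
  have key : projB p σ hij.le = (φ.toMonoidHom.comp (resHom h')).comp ψ.symm.toMonoidHom := by
    refine groupB_hom_ext hC.generates ?_ ?_
    · have e : ψ.symm (SemidirectProduct.inr σ) = s := by rw [MulEquiv.symm_apply_eq, hψs]
      refine (SemidirectProduct.map_inr _ _ _ σ).trans ?_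
      exact hs.symm.trans (congrArg (fun t => φ (resHom h' t)) e.symm)
    · have e : ψ.symm (SemidirectProduct.inl (.ofAdd (Submodule.Quotient.mk 1))) = ν := by
        rw [MulEquiv.symm_apply_eq, hψν]
      refine (SemidirectProduct.map_inl _ _ _ _).trans ?_
      exact hνφ.symm.trans (congrArg (fun t => φ (resHom h' t)) e.symm)
  rw [key, ← (resHom_eq_iff h').2 hg]
  exact congrArg (fun t => φ (resHom h' t)) (ψ.symm_apply_apply g)

/-- For `i < p` the explicit field is a solution with respect to every identification. -/
theorem isSolutionFor_solutionField (hC : IsCyclicKummer p σ) {i j : ℕ} (hj : 1 ≤ j)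
    (hij : j < i) (hi : i < p) {γ ω c : Kˣ} (hγ : rhoPow σ (p - j) ω = γ * c ^ p) (f : Fˣ)
    (hL : L = kummerField p σ γ) {φ : (L ≃ₐ[F] L) ≃* groupB p σ j}
    (hφ : IsIdentification p σ L φ) :
    IsSolutionFor p σ hij.le L φ (solutionField p σ i j L f ω) := by
  have hp := hC.prime.pos
  have hδγ := rhoPow_sub_baseUnit_mul hij hi.le hγ f
  have h : K ≤ L := hL ▸ le_kummerField γ
  have h' : L ≤ solutionField p σ i j L f ω := le_sup_left
  have hLt : solutionField p σ i j L f ω =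
      kummerField p σ (baseUnit K f * rhoPow σ (p - i) ω) := by
    rw [hL, solutionField_eq_kummerField hC hij hi.le hγ]
  generalize solutionField p σ i j L f ω = Lt at *
  set δ := baseUnit K f * rhoPow σ (p - i) ω with hδ
  have : IsGalois F L := hL ▸ isGalois_kummerField hC γ
  have : IsGalois F Lt := hLt ▸ isGalois_kummerField hC δ
  obtain ⟨s, hs⟩ := resHom_surjective h' (φ.symm (SemidirectProduct.inr σ))
  have hsK : IsRestriction s σ :=
    ((resHom_eq_iff h').1 hs).trans h h' (hφ.isRestriction_symm h _)
  have hroot : HasRoot p Lt δ := by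
    rw [hLt]
    exact hasRoot_kummerField hp δ 0
  obtain ⟨y, hy⟩ := hroot.exists_unit hp (h.trans h')
  -- As `i < p`, the factor `ω^{ρ^{p-i}}` has norm `1`. The product of the conjugates of `y` is then
  -- a `p`th root of `f^p`, hence in `F` and fixed by whichever lift `s` was taken.
  have hN : orbitProd σ p δ = baseUnit K f ^ p := by
    rw [hδ, map_mul, orbitProd_baseUnit, orbitProd_rhoPow_eq_one σ
      (pow_eq_one_generator hp hC.finrank_eq hC.generates) (by omega), mul_one]
  have hn : orbitProd s p y ^ p = baseUnit Lt f ^ p := by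
    rw [← map_pow, hy, hsK.orbitProd_inclUnit, hN, map_pow, inclUnit_baseUnit]
  obtain ⟨f', -, hf'⟩ := exists_eq_baseUnit_mul_of_pow_eq hp hC.exists_root hn
  refine isSolutionFor_of_lift hC hj hij hi.le hδγ h h' hL hLt hφ (s := s) ?_
    (by rw [hs, MulEquiv.apply_symm_apply])
  refine pow_eq_one_of_unitsAct_orbitProd hC (h.trans h') hLt hsK hy ?_
  rw [hf', ← map_mul, unitsAct_baseUnit]

/-- A lift of `σ` of order `p` in the case `i = p`. -/
theorem exists_lift_pow_eq_one (hC : IsCyclicKummer p σ) {j : ℕ} (hj : 1 ≤ j)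
    (hij : j < p) {γ δ c : Kˣ} (hδγ : rhoPow σ (p - j) δ = γ * c ^ p) (h : K ≤ L) (h' : L ≤ Lt)
    (hL : L = kummerField p σ γ) (hLt : Lt = kummerField p σ δ) [IsGalois F L] [IsGalois F Lt]
    {φ : (L ≃ₐ[F] L) ≃* groupB p σ j} (hφ : IsIdentification p σ L φ) :
    ∃ s : Lt ≃ₐ[F] Lt, IsRestriction s σ ∧ s ^ p = 1 := by
  have hp := hC.prime.pos
  have hξ := hC.exists_root
  have hK := h.trans h'
  obtain ⟨s₀, hs₀⟩ := exists_isRestriction_lift hK σ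
  obtain ⟨ν, hν⟩ := resHom_surjective h'
    (φ.symm (SemidirectProduct.inl (.ofAdd (Submodule.Quotient.mk 1))))
  have hνφ : φ (resHom h' ν) = SemidirectProduct.inl (.ofAdd (Submodule.Quotient.mk 1)) := by
    rw [hν, MulEquiv.apply_symm_apply]
  have hνK : IsRestriction ν (1 : K ≃ₐ[F] K) :=
    ((resHom_eq_iff h').1 hν).trans h h' (hφ.isRestriction_symm h _)
  have hroot : HasRoot p Lt δ := by
    rw [hLt]
    exact hasRoot_kummerField hp δ 0
  obtain ⟨y, hy⟩ := hroot.exists_unit hp hK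
  have hσp := pow_eq_one_generator hp hC.finrank_eq hC.generates
  obtain ⟨m, hm⟩ : ∃ m : Fˣ, orbitProd σ p δ = baseUnit K m := by
    refine fixed_of_unitsAct_eq hp hC.finrank_eq hC.generates ?_
    rw [← div_eq_one, ← unitsAct_pow_div, hσp, unitsAct_one, div_self']
  obtain ⟨v, hv⟩ := exists_orbitProd_eq σ hC.prime δ
  have hr : rhoPow s₀ (p - 1) y ^ p = inclUnit hK (rhoPow σ (p - 1) δ) := by
    rw [← rhoPow_pow, hy, hs₀.rhoPow_inclUnit]
  -- A `p`th root of the norm `m` of `δ`, since `N(δ)` is `δ^{ρ^{p-1}} v^p`. Being essentially the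
  -- radical `y^{ρ^{p-1}}`, it is moved by `ν`.
  set b : Ltˣ := rhoPow s₀ (p - 1) y * inclUnit hK v with hb
  have hbp : b ^ p = baseUnit Lt m := by
    rw [hb, mul_pow, hr, ← map_pow, ← map_mul, ← hv, hm, inclUnit_baseUnit]
  obtain ⟨z, hzp, hz⟩ := exists_isPair hp hξ hK hνK hr
  have hz1 : z ≠ 1 := by
    rintro rfl
    exact lift_generator_moves hC hj hij le_rfl hδγ h h' hL hφ hνφ hr (isPair_one_iff.1 hz)
  have hzb : IsPair ν b z := by
    have h1 := hz.mul_right (isPair_inclUnit hK hνK v)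
    rwa [mul_one] at h1
  obtain ⟨f₀, hf₀, hs₀b⟩ := exists_eq_baseUnit_mul_of_pow_eq hp hξ (u := unitsAct s₀ b) (v := b)
    (by rw [← map_pow, hbp, unitsAct_baseUnit])
  -- The exponent is chosen so that `ν^e` undoes the factor `f₀` by which `s₀` multiplies `b`.
  obtain ⟨e, he⟩ := exists_pow_eq_of_pow_eq_one hC.prime hzp hz1 (κ := f₀⁻¹)
    (by rw [inv_pow, hf₀, inv_one])
  have hsb : IsPair (ν ^ e * s₀) b 1 := by
    have h1 := (hzb.pow e).mul (g' := s₀) (f' := f₀) hs₀b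
    rwa [he, inv_mul_cancel] at h1
  have hsK : IsRestriction (ν ^ e * s₀) σ := by
    rw [← resHom_eq_iff hK, map_mul, map_pow, (resHom_eq_iff hK).2 hνK, (resHom_eq_iff hK).2 hs₀,
      one_pow, one_mul]
  refine ⟨ν ^ e * s₀, hsK, pow_eq_one_of_unitsAct_orbitProd hC hK hLt hsK hy ?_⟩
  -- The product of the conjugates of `y` is another `p`th root of `m`, so it is fixed along with
  -- `b`.
  obtain ⟨f', -, hf'⟩ := exists_eq_baseUnit_mul_of_pow_eq hp hξ
    (u := orbitProd (ν ^ e * s₀) p y) (v := b)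
    (by rw [← map_pow, hy, hsK.orbitProd_inclUnit, hm, inclUnit_baseUnit, hbp])
  rw [hf', map_mul, unitsAct_baseUnit, isPair_one_iff.1 hsb]

/-- For `i = p` not every lift of `σ` need have order `p`. A good lift is chosen first, and the
identification of `Gal(L/F)` is rebuilt so that its restriction to `L` corresponds to `σ`. -/
theorem isSolution_solutionField (hC : IsCyclicKummer p σ) {i j : ℕ} (hj : 1 ≤ j)
    (hij : j < i) (hi : i ≤ p) {γ ω c : Kˣ} (hγ : rhoPow σ (p - j) ω = γ * c ^ p) (f : Fˣ)
    (hL : L = kummerField p σ γ) {φ : (L ≃ₐ[F] L) ≃* groupB p σ j}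
    (hφ : IsIdentification p σ L φ) : IsSolution p σ hij.le L (solutionField p σ i j L f ω) := by
  rcases hi.lt_or_eq with hi | rfl
  · exact ⟨φ, hφ, isSolutionFor_solutionField hC hj hij hi hγ f hL hφ⟩
  have hp := hC.prime.pos
  have hδγ := rhoPow_sub_baseUnit_mul hij hi hγ f
  have h : K ≤ L := hL ▸ le_kummerField γ
  have h' : L ≤ solutionField i σ i j L f ω := le_sup_left
  have hLt : solutionField i σ i j L f ω =
      kummerField i σ (baseUnit K f * rhoPow σ (i - i) ω) := by
    rw [hL, solutionField_eq_kummerField hC hij hi hγ]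
  generalize solutionField i σ i j L f ω = Lt at *
  set δ := baseUnit K f * rhoPow σ (i - i) ω
  have : IsGalois F L := hL ▸ isGalois_kummerField hC γ
  have : IsGalois F Lt := hLt ▸ isGalois_kummerField hC δ
  obtain ⟨s, hs, hsp⟩ := exists_lift_pow_eq_one hC hj hij hδγ h h' hL hLt hφ
  have hroot : HasRoot i L γ := by
    rw [hL]
    exact hasRoot_kummerField hp γ 0
  obtain ⟨y, hy⟩ := hroot.exists_unit hp h
  have hsL : IsRestriction (resHom h' s) σ := (isRestriction_resHom h' s).of_trans h h' hs
  obtain ⟨c', hc'⟩ := hφ.exists_rhoPow_eq_pow hC h hy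
  obtain ⟨φ', hφ', hφs, -⟩ := exists_identification hC h hL hc' hsL
    (by rw [← map_pow, hsp, map_one]) hy (hφ.isRestriction_symm h _)
    (hφ.generator_moves hC h hL hj hij.le (by rw [← rhoPow_pow, hy, hsL.rhoPow_inclUnit]))
  exact ⟨φ', hφ', isSolutionFor_of_lift hC hj hij hi hδγ h h' hL hLt hφ' hsp hφs⟩

end Solutions

/-! ### Realizing characters by radicals -/

section Characters

variable {F Ω : Type*} [Field F] [Field Ω] [Algebra F Ω] {E : IntermediateField F Ω}

/-- Identifying the `p`th roots of unity with `𝔽_p` turns Kummer characters into linear functionals,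
to which vector space duality applies. -/
theorem exists_zmod_exp {p : ℕ} (hp : 0 < p) (hξ : ∃ ξ : F, IsPrimitiveRoot ξ p) :
    ∃ ex : Multiplicative (ZMod p) →* Fˣ, Function.Injective ex ∧
      ∀ f : Fˣ, f ^ p = 1 → ∃ c, ex c = f := by
  obtain ⟨ξ, hξ⟩ := hξ
  obtain ⟨z, rfl⟩ := hξ.isUnit hp.ne'
  have := NeZero.of_pos hp
  have hz : IsPrimitiveRoot z p := IsPrimitiveRoot.coe_units_iff.1 hξ
  refine ⟨(Subgroup.zpowers z).subtype.comp
    (AddMonoidHom.toMultiplicativeLeft hz.zmodEquivZPowers.toAddMonoidHom), ?_, fun f hf => ?_⟩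
  · intro a b hab
    exact hz.zmodEquivZPowers.injective (Subtype.ext hab)
  · obtain ⟨k, -, hk⟩ := hξ.eq_pow_of_pow_eq_one (ξ := (f : F))
      (by rw [← Units.val_pow_eq_pow_val, hf, Units.val_one])
    have hk' : z ^ k = f := Units.ext (by simpa using hk)
    obtain ⟨c, hc⟩ := hz.zmodEquivZPowers.surjective
      (Additive.ofMul ⟨f, hk' ▸ Subgroup.npow_mem_zpowers z k⟩)
    exact ⟨.ofAdd c, congrArg (fun x : Additive (Subgroup.zpowers z) => (x.toMul : Fˣ)) hc⟩

/-- Every character with values in `Fˣ` of a finite group of automorphisms is a Kummer character. -/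
theorem exists_isPair_of_character {V : Type*} [Group V] [Finite V] {T : V →* (E ≃ₐ[F] E)}
    (hT : Function.Injective T) (m : V →* Fˣ) : ∃ y : Eˣ, ∀ x, IsPair (T x) y (m x) := by
  have := Fintype.ofFinite V
  -- The radical is the resolvent `∑ m(x)⁻¹ T(x)(w)`, nonzero for a suitable `w` by independence of
  -- automorphisms.
  obtain ⟨w, hw⟩ := exists_sum_mul_ne_zero hT (a := fun x => (baseUnit E (m x)⁻¹ : E))
    ⟨1, Units.ne_zero _⟩
  refine ⟨Units.mk0 _ hw, fun x => Units.ext ?_⟩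
  simp only [coe_unitsAct, Units.val_mk0, Units.val_mul, map_sum, Finset.mul_sum]
  refine Fintype.sum_equiv (Equiv.mulLeft x) _ _ fun v => ?_
  rw [Equiv.coe_mulLeft, map_mul, map_mul, map_mul, mul_inv, map_mul, Units.val_mul,
    AlgEquiv.mul_apply, ← mul_assoc, ← mul_assoc, ← Units.val_mul, ← map_mul (baseUnit E),
    mul_inv_cancel, map_one, Units.val_one, one_mul]
  congr 1
  exact congrArg Units.val (unitsAct_baseUnit (T x) (m v)⁻¹)

/-- The Kummer character of `y`, written additively. -/
theorem exists_zmod_character {p : ℕ} {V : Type*} [AddGroup V]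
    {ex : Multiplicative (ZMod p) →* Fˣ} (hex : Function.Injective ex)
    (hex' : ∀ f : Fˣ, f ^ p = 1 → ∃ c, ex c = f) (T : Multiplicative V →* (E ≃ₐ[F] E)) {y : Eˣ}
    (hy : ∀ x, ∃ f : Fˣ, f ^ p = 1 ∧ IsPair (T x) y f) :
    ∃ χ : V →+ ZMod p, ∀ x, IsPair (T (.ofAdd x)) y (ex (.ofAdd (χ x))) := by
  have h (x : V) : ∃ c : ZMod p, IsPair (T (.ofAdd x)) y (ex (.ofAdd c)) := by
    obtain ⟨f, hf, hfy⟩ := hy (.ofAdd x)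
    obtain ⟨c, rfl⟩ := hex' f hf
    exact ⟨c.toAdd, hfy⟩
  choose χ hχ using h
  refine ⟨AddMonoidHom.mk' χ fun a b => ?_, hχ⟩
  apply Multiplicative.ofAdd.injective
  apply hex
  rw [ofAdd_add, map_mul]
  refine (hχ (a + b)).unique ?_
  rw [ofAdd_add, map_mul]
  exact (hχ a).mul (hχ b)

instance finite_quotA (p : ℕ) [NeZero p] {G : Type*} [Group G] [Finite G] (σ : G) (i : ℕ) :
    Finite (quotA p σ i) := by
  have : Finite (MonoidAlgebra (ZMod p) G) :=
    Finite.of_injective (fun a : MonoidAlgebra (ZMod p) G => (fun g => a.coeff g)) fun a b h => by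
      ext g
      exact congrFun h g
  exact Finite.of_surjective _ (Submodule.Quotient.mk_surjective (subA p σ i))

end Characters

/-! ### Every solution is explicit -/

section Converse

variable {p : ℕ} {F Ω : Type*} [Field F] [Field Ω] [Algebra F Ω] {K L Lt : IntermediateField F Ω}
  {σ : K ≃ₐ[F] K} [IsGalois F K]

/-- A functional on `A / A_i` that vanishes on `A_j / A_i` is divisible by `(τ⁻¹ - 1)^{i-j}`. -/
theorem exists_functional (hC : IsCyclicKummer p σ) {i j : ℕ} (hij : j ≤ i) (hi : i ≤ p)
    (χ : quotA p σ i →+ ZMod p)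
    (hχ : ∀ a ∈ subA p σ j, χ (Submodule.Quotient.mk a) = 0) :
    ∃ χ' : quotA p σ i →+ ZMod p, ∀ a,
      χ' (Submodule.Quotient.mk (augGen p σ⁻¹ ^ (i - j) * a)) = χ (Submodule.Quotient.mk a) := by
  have := Fact.mk hC.prime
  let m : quotA p σ i →ₗ[ZMod p] quotA p σ i := AddMonoidHom.toZModLinearMap p
    (DistribSMul.toAddMonoidHom (quotA p σ i) (augGen p σ⁻¹ ^ (i - j)))
  have hm (a) : m (Submodule.Quotient.mk a) =
      Submodule.Quotient.mk (augGen p σ⁻¹ ^ (i - j) * a) := rfl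
  -- The image of a transpose is the annihilator of the kernel, and the kernel of multiplication by
  -- `(τ⁻¹ - 1)^{i-j}` lies in `A_j/A_i`.
  have hmem : AddMonoidHom.toZModLinearMap p χ ∈ LinearMap.range m.dualMap := by
    rw [LinearMap.range_dualMap_eq_dualAnnihilator_ker, Submodule.mem_dualAnnihilator]
    intro x hx
    obtain ⟨a, rfl⟩ := Submodule.Quotient.mk_surjective _ x
    rw [LinearMap.mem_ker, hm, Submodule.Quotient.mk_eq_zero, ← subA_inv hC.generates] at hx
    have hgen : ∀ g : K ≃ₐ[F] K, g ∈ Subgroup.zpowers σ⁻¹ := fun g => by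
      rw [Subgroup.zpowers_inv]
      exact hC.generates g
    have hord : orderOf σ⁻¹ = p := by
      rw [orderOf_inv, orderOf_generator hC.prime.pos hC.finrank_eq hC.generates]
    have h1 := mem_subA_of_pow_mul_mem hgen hord hij hi hx
    rw [subA_inv hC.generates] at h1
    exact hχ a h1
  obtain ⟨χ', h⟩ := hmem
  exact ⟨χ'.toAddMonoidHom, fun a => LinearMap.congr_fun h (Submodule.Quotient.mk a)⟩

variable [IsAlgClosed Ω]

/-- Every solution comes from some `δ` with `[δ]^{ρ^{i-j}} = [γ]`. -/
theorem exists_radical_of_isSolution (hC : IsCyclicKummer p σ) {i j : ℕ} (hj : 1 ≤ j)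
    (hij : j < i) (hi : i ≤ p) {γ : Kˣ} (hL : L = kummerField p σ γ)
    (hLt : IsSolution p σ hij.le L Lt) :
    ∃ δ c : Kˣ, rhoPow σ (i - j) δ = γ * c ^ p ∧ Lt = kummerField p σ δ ∧
      (i < p → ∃ f : Fˣ, orbitProd σ p δ = baseUnit K f ^ p) := by
  have hp := hC.prime.pos
  have hξ := hC.exists_root
  have := Fact.mk hC.prime
  have : FiniteDimensional F K := FiniteDimensional.of_finrank_pos (hC.finrank_eq ▸ hp)
  obtain ⟨φ, hφ, h', hGal, ψ, hψ⟩ := hLt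
  have h : K ≤ L := hL ▸ le_kummerField γ
  have hK := h.trans h'
  have : IsGalois F L := hL ▸ isGalois_kummerField hC γ
  have hψid : IsIdentification p σ Lt ψ := by
    intro g g' hg
    have h1 := hψ g _ (isRestriction_resHom h' g)
    have h2 := hφ (resHom h' g) g' ((isRestriction_resHom h' g).of_trans h h' hg)
    rw [← h1] at h2
    exact h2
  have hgen : ∀ g : K ≃ₐ[F] K, g ∈ Subgroup.zpowers σ⁻¹ := fun g => by
    rw [Subgroup.zpowers_inv]
    exact hC.generates g
  have hs := hψid.isRestriction_symm hK (SemidirectProduct.inr σ)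
  rw [SemidirectProduct.right_inr] at hs
  set s := ψ.symm (SemidirectProduct.inr σ) with hsdef
  have hT (a : MonoidAlgebra (ZMod p) (K ≃ₐ[F] K)) :
      IsRestriction (ψ.symm (SemidirectProduct.inl (.ofAdd (Submodule.Quotient.mk a))))
        (1 : K ≃ₐ[F] K) := hψid.isRestriction_symm hK _
  have hTθ := identification_symm_augGen_mul ψ
  let T : Multiplicative (quotA p σ i) →* (Lt ≃ₐ[F] Lt) :=
    ψ.symm.toMonoidHom.comp SemidirectProduct.inl
  have hTinj : Function.Injective T := ψ.symm.injective.comp SemidirectProduct.inl_injective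
  have hT' (x) : IsRestriction (T x) (1 : K ≃ₐ[F] K) := hψid.isRestriction_symm hK _
  have hTL (a : MonoidAlgebra (ZMod p) (K ≃ₐ[F] K)) :
      φ (resHom h' (T (.ofAdd (Submodule.Quotient.mk a)))) =
        SemidirectProduct.inl (.ofAdd (Submodule.Quotient.mk a)) := by
    rw [← hψ _ _ (isRestriction_resHom h' _)]
    refine (congrArg (projB p σ hij.le) (ψ.apply_symm_apply _)).trans ?_
    exact SemidirectProduct.map_inl _ _ _ _
  obtain ⟨ex, hex, hex'⟩ := exists_zmod_exp hp hξ
  have hroot : HasRoot p L γ := by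
    rw [hL]
    exact hasRoot_kummerField hp γ 0
  obtain ⟨b, hb⟩ := hroot.exists_unit hp h
  have hbt : inclUnit h' b ^ p = inclUnit hK γ := by
    rw [← map_pow, hb]
    rfl
  obtain ⟨χγ, hχγ⟩ := exists_zmod_character hex hex' T
    (fun x => exists_isPair hp hξ hK (hT' x) hbt)
  -- Elements of `A_j` restrict to the identity on `L`, where the root of `γ` lives.
  have hχγ0 (a) (ha : a ∈ subA p σ j) : χγ (Submodule.Quotient.mk a) = 0 := by
    have h1 := hTL a
    rw [(Submodule.Quotient.mk_eq_zero _).2 ha, ofAdd_zero, map_one, map_eq_one_iff φ φ.injective,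
      resHom_eq_iff] at h1
    have h2 : IsPair (T (.ofAdd (Submodule.Quotient.mk a))) (inclUnit h' b) 1 :=
      isPair_inclUnit h' h1 b
    have h3 := (hχγ _).unique h2
    rw [map_eq_one_iff ex hex] at h3
    exact h3
  obtain ⟨χ, hχ⟩ := exists_functional hC hij.le hi χγ hχγ0
  obtain ⟨y, hy⟩ := exists_isPair_of_character hTinj
    (ex.comp (AddMonoidHom.toMultiplicative χ))
  have hy' (a : MonoidAlgebra (ZMod p) (K ≃ₐ[F] K)) :
      IsPair (T (.ofAdd (Submodule.Quotient.mk a))) y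
        (ex (.ofAdd (χ (Submodule.Quotient.mk a)))) := hy _
  have hKmem {u : Ltˣ} (hu : ∀ a : MonoidAlgebra (ZMod p) (K ≃ₐ[F] K),
      IsPair (T (.ofAdd (Submodule.Quotient.mk a))) u 1) : ∃ v : Kˣ, inclUnit hK v = u := by
    refine exists_inclUnit_eq hK (mem_of_fixed hK fun g hg => ?_)
    obtain ⟨a, rfl⟩ := hψid.exists_eq hg
    exact congrArg Units.val (isPair_one_iff.1 (hu a))
  -- The character of `y` takes values in the `p`th roots of unity, so `y^p` is fixed by
  -- `Gal(Lt/K)`.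
  obtain ⟨δ, hδ⟩ : ∃ δ : Kˣ, inclUnit hK δ = y ^ p := by
    refine hKmem fun a => ?_
    have h1 : (ex (.ofAdd (χ (Submodule.Quotient.mk a)))) ^ p = 1 := by
      rw [← map_pow, ← ofAdd_nsmul, nsmul_eq_mul, CharP.cast_eq_zero, zero_mul, ofAdd_zero, map_one]
    rw [isPair_one_iff, map_pow, hy' a, mul_pow, ← map_pow, h1, map_one, one_mul]
  have hyk (k : ℕ) : rhoPow s k y ^ p = inclUnit hK (rhoPow σ k δ) := by
    rw [← rhoPow_pow, ← hδ, hs.rhoPow_inclUnit]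
  have hθ (k : ℕ) (a) {f : Fˣ}
      (hf : IsPair (T (.ofAdd (Submodule.Quotient.mk a))) (rhoPow s k y) f) :
      ex (.ofAdd (χ (Submodule.Quotient.mk (augGen p σ⁻¹ ^ k * a)))) = f :=
    (hy' _).unique (isPair_augGen_pow hp hξ hK hs hT hTθ hδ.symm k hf)
  -- By adjointness `y^{ρ^{i-j}}` has the same character as the root of `γ`, so their quotient lies
  -- in `K`.
  obtain ⟨c, hc⟩ : ∃ c : Kˣ, inclUnit hK c = rhoPow s (i - j) y / inclUnit h' b := by
    refine hKmem fun a => ?_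
    obtain ⟨f, -, hf⟩ := exists_isPair hp hξ hK (hT a) (hyk (i - j))
    have h1 := hf.div_right (hχγ (Submodule.Quotient.mk a))
    rwa [← hθ (i - j) a hf, hχ, div_self'] at h1
  have hδγ : rhoPow σ (i - j) δ = γ * c ^ p := by
    apply inclUnit_injective hK
    rw [← hyk, map_mul, map_pow, hc, div_pow, hbt, mul_div_cancel]
  have hδroot : HasRoot p Lt δ := hasRoot_of_unit hK hδ.symm
  have hle : kummerField p σ δ ≤ Lt := kummerField_le_of_normal hp hξ hK hδroot
  have hmove := lift_generator_moves hC hj hij hi hδγ h h' hL hφ (hTL 1) (hyk (i - 1))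
  have hLtδ : Lt = kummerField p σ δ := by
    refine le_antisymm (fun x hx => ?_) hle
    refine mem_of_fixed hle (x := ⟨x, hx⟩) fun g hg => ?_
    have hgK : IsRestriction g (1 : K ≃ₐ[F] K) :=
      hg.trans (le_kummerField δ) hle IsRestriction.one
    obtain ⟨a, rfl⟩ := hψid.exists_eq hgK
    have hfix (k : ℕ) : IsPair (T (.ofAdd (Submodule.Quotient.mk a))) (rhoPow s k y) 1 := by
      obtain ⟨u, hu⟩ := exists_inclUnit_eq hle (u := rhoPow s k y) (mem_kummerField (k := k) (by
        have h1 := congrArg (fun v : Ltˣ => ((v : Lt) : Ω)) (hyk k)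
        simpa using h1))
      rw [← hu]
      exact isPair_inclUnit hle hg u
    -- The automorphism of `a` fixes every radical, so `χ` vanishes on all `(τ⁻¹ - 1)^k a`. For `a`
    -- outside `A_i` this would include a generator of the socle, on which `χ` is nonzero by
    -- `hmove`.
    have ha : a ∈ subA p σ i := by
      rw [← subA_inv hC.generates]
      by_contra hmem
      obtain ⟨k, d, hd, hk⟩ := exists_pow_mul_sub_mem hgen hmem
      rw [subA_inv hC.generates, ← Submodule.Quotient.eq] at hk
      have h1 := hθ k a (hfix k)
      rw [map_eq_one_iff ex hex] at h1
      have h2 : χ (Submodule.Quotient.mk (d • augGen p σ⁻¹ ^ (i - 1))) = 0 := hk ▸ h1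
      have h3 : d • augGen p σ⁻¹ ^ (i - 1) = d.val • (augGen p σ⁻¹ ^ (i - 1) * 1) := by
        rw [mul_one, ← Nat.cast_smul_eq_nsmul (ZMod p), ZMod.natCast_zmod_val]
      rw [h3, Submodule.Quotient.mk_smul, map_nsmul, nsmul_eq_mul, ZMod.natCast_zmod_val,
        mul_eq_zero, or_iff_right hd] at h2
      obtain ⟨f, -, hf⟩ := exists_isPair hp hξ hK (hT 1) (hyk (i - 1))
      have h4 := hθ (i - 1) 1 hf
      rw [h2, ofAdd_zero, map_one] at h4
      rw [← h4] at hf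
      exact hmove (isPair_one_iff.1 hf)
    rw [(Submodule.Quotient.mk_eq_zero _).2 ha, ofAdd_zero, map_one, map_one]
    rfl
  refine ⟨δ, c, hδγ, hLtδ, fun hip => ?_⟩
  obtain ⟨d, hd⟩ := exists_rhoPow_eq_pow_of_eq hC hij hδγ h hL hφ
  obtain ⟨v, hv⟩ := exists_orbitProd_eq σ hC.prime δ
  -- Because `i ≤ p - 1`, the factor `δ^{ρ^{p-1}}` of the norm is already a `p`th power. So the
  -- product of the conjugates of `y` lies in `K`; it is fixed by `s`, which has order dividing `p`,
  -- and therefore lies in `F`.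
  have hN : orbitProd σ p δ = (rhoPow σ (p - 1 - i) d * v) ^ p := by
    rw [hv, mul_pow, ← rhoPow_pow, ← hd, ← rhoPow_add]
    congr 3
    omega
  have hσp := pow_eq_one_generator hp hC.finrank_eq hC.generates
  have hsp : s ^ p = 1 := by
    rw [hsdef, ← map_pow, ← map_pow, hσp, map_one, map_one]
  obtain ⟨m, hm⟩ := exists_inclUnit_of_pow_eq hp hξ hK (y := orbitProd s p y)
    (by rw [← map_pow, ← hδ, hs.orbitProd_inclUnit, hN])
  have hsn : unitsAct s (orbitProd s p y) = orbitProd s p y := by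
    rw [← div_eq_one, ← unitsAct_pow_div, hsp, unitsAct_one, div_self']
  rw [hm, hs.unitsAct_inclUnit] at hsn
  obtain ⟨f, rfl⟩ := fixed_of_unitsAct_eq hp hC.finrank_eq hC.generates
    (inclUnit_injective hK hsn)
  refine ⟨f, inclUnit_injective hK ?_⟩
  rw [map_pow, ← hm, ← map_pow, ← hδ, hs.orbitProd_inclUnit]

theorem exists_solutionField_of_isSolution (hC : IsCyclicKummer p σ) {i j : ℕ} (hj : 1 ≤ j)
    (hij : j < i) (hi : i ≤ p) {γ : Kˣ} (hL : L = kummerField p σ γ)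
    {φ : (L ≃ₐ[F] L) ≃* groupB p σ j} (hφ : IsIdentification p σ L φ)
    (hLt : IsSolution p σ hij.le L Lt) :
    ∃ (ω c : Kˣ) (f : Fˣ), rhoPow σ (p - j) ω = γ * c ^ p ∧ Lt = solutionField p σ i j L f ω := by
  obtain ⟨δ, c, hδγ, hLtδ, hN⟩ := exists_radical_of_isSolution hC hj hij hi hL hLt
  obtain ⟨f, ω, rfl⟩ : ∃ (f : Fˣ) (ω : Kˣ), δ = baseUnit K f * rhoPow σ (p - i) ω := by
    rcases hi.lt_or_eq with hip | rfl
    · obtain ⟨f₀, hf₀⟩ := hN hip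
      have : IsGalois F L := hL ▸ isGalois_kummerField hC γ
      obtain ⟨d, hd⟩ := exists_rhoPow_eq_pow_of_eq hC hij hδγ (hL ▸ le_kummerField γ) hL hφ
      exact exists_eq_baseUnit_mul_rhoPow hC.prime hC.two_lt hC.exists_root hC.finrank_eq
        hC.generates (n := p - i) (by omega) (by omega) hf₀ (c := d)
        (by rw [← hd, show p - (p - i) = i by omega])
    -- For `i = p` the exponent `p - i` is zero and no descent is needed: `ω` is `δ` itself.
    · exact ⟨1, δ, by rw [map_one, one_mul, Nat.sub_self, rhoPow_zero]⟩
  have hγ : rhoPow σ (p - j) ω = γ * c ^ p := by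
    rw [← hδγ, rhoPow_baseUnit_mul σ (by omega), ← rhoPow_add]
    congr 1
    omega
  exact ⟨ω, c, f, hγ, by rw [hLtδ, hL, solutionField_eq_kummerField hC hij hi hγ]⟩

end Converse

end GaloisModuleEmbedding

/-! ### The main theorem -/

open GaloisModuleEmbedding in
theorem theorem2 {p : ℕ} (hp : p.Prime) (hp2 : 2 < p)
    {F Ω : Type*} [Field F] [Field Ω] [Algebra F Ω] [IsAlgClosed Ω]
    (hξ : ∃ ξ : F, IsPrimitiveRoot ξ p)
    (K : IntermediateField F Ω) [IsGalois F K] (hK : Module.finrank F K = p)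
    (σ : K ≃ₐ[F] K) (hσ : ∀ g : K ≃ₐ[F] K, g ∈ Subgroup.zpowers σ)
    (i j : ℕ) (hj : 1 ≤ j) (hij : j < i) (hi : i ≤ p)
    (γ : Kˣ) (L : IntermediateField F Ω)
    (hL : L = IntermediateField.normalClosure F (rootField p γ) Ω)
    (hB : ∃ φ : (L ≃ₐ[F] L) ≃* groupB p σ j, IsIdentification p σ L φ) :
    ((∃ Lt : IntermediateField F Ω, IsSolution p σ hij.le L Lt) ↔
      ∃ ω : Kˣ, (γ : PowerClasses p K) = (rhoPow σ (p - j) ω : PowerClasses p K)) ∧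
    (∀ Lt : IntermediateField F Ω, IsSolution p σ hij.le L Lt ↔
      ∃ (ω : Kˣ) (f : Fˣ),
        (γ : PowerClasses p K) = (rhoPow σ (p - j) ω : PowerClasses p K) ∧
          Lt = solutionField p σ i j L f ω) ∧
    (i < p → ∀ φ : (L ≃ₐ[F] L) ≃* groupB p σ j, IsIdentification p σ L φ →
      ∀ Lt : IntermediateField F Ω, IsSolution p σ hij.le L Lt →
        IsSolutionFor p σ hij.le L φ Lt) := by
  have hC : IsCyclicKummer p σ := ⟨hp, hp2, hξ, hK, hσ⟩
  rw [normalClosure_rootField hC] at hL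
  obtain ⟨φ₀, hφ₀⟩ := hB
  have main (Lt : IntermediateField F Ω) : IsSolution p σ hij.le L Lt ↔
      ∃ (ω : Kˣ) (f : Fˣ),
        (γ : PowerClasses p K) = (rhoPow σ (p - j) ω : PowerClasses p K) ∧
          Lt = solutionField p σ i j L f ω := by
    constructor
    · intro hLt
      obtain ⟨ω, c, f, hγ, h⟩ := exists_solutionField_of_isSolution hC hj hij hi hL hφ₀ hLt
      exact ⟨ω, f, powerClasses_eq_iff.2 ⟨c, hγ⟩, h⟩
    · rintro ⟨ω, f, hω, rfl⟩
      obtain ⟨c, hc⟩ := powerClasses_eq_iff.1 hω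
      exact isSolution_solutionField hC hj hij hi hc f hL hφ₀
  refine ⟨⟨?_, ?_⟩, main, ?_⟩
  · rintro ⟨Lt, hLt⟩
    obtain ⟨ω, -, hω, -⟩ := (main Lt).1 hLt
    exact ⟨ω, hω⟩
  · rintro ⟨ω, hω⟩
    exact ⟨_, (main _).2 ⟨ω, 1, hω, rfl⟩⟩
  · intro hip φ hφ Lt hLt
    obtain ⟨ω, f, hω, rfl⟩ := (main Lt).1 hLt
    obtain ⟨c, hc⟩ := powerClasses_eq_iff.1 hω
    exact isSolutionFor_solutionField hC hj hij hip hc f hL hφ
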